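/- Theorem. Let $n\ge 2$ be an integer, $\eta=e^{\pi i/n}$, and for $h\in\mathbb Z$ put $\mathcal Z_h=\sum_{j=0}^{n-1}\eta^{j(1-h)}$. Let $B_k(y)$ denote the Bernoulli polynomials, defined by $\frac{te^{ty}}{e^t-1}=\sum_{k\ge0}B_k(y)\frac{t^k}{k!}$. Let $p\in\mathbb Z$ and $y\in\mathbb R$, and assume that either $0<y<1$, or $y\in\{0,1\}$ and $p>n/2$. Then the series below converges absolutely and $$\mathcal Z_{2p+1}\sum_{m\in\mathbb Z\setminus\{0\}}\frac{\cos(2m\pi y)}{m^{2p+1-n}}\prod_{j=1}^{n-1}\frac{\cosh\left(2m\pi i\eta^j(y-1/2)\right)}{\sinh(m\pi i\eta^j)}=-\frac{2^{n-1}(2\pi i)^{2p+1-n}}{\eta^{n(n-1)/2}}\sum_{\substack{m_1,\dots,m_n\ge0\\ m_1+\cdots+m_n=p}}\ \prod_{\nu=1}^n\frac{B_{2m_\nu}(y)}{(2m_\nu)!}\eta^{2(\nu-1)m_\nu},$$ where the sum on the right runs over $n$-tuples of integers and is $0$ if $p<0$. Furthermore, if $0<y<1$ and $p\ge n/2$,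 then both sides are also equal to $$\frac{(2\pi i)^{2p+1-n}(-1)^{1-n}}{2\,(2p-n)!}\sum_{y_0\in\{y,1-y\}}\cdots\sum_{y_{n-1}\in\{y,1-y\}}\zeta_n\Big(n-2p,\ \sum_{j=0}^{n-1}\eta^jy_j;\ 1,\eta,\dots,\eta^{n-1}\Big),$$ where each of the $n$ sums has two terms, $y_j=y$ and $y_j=1-y$ (also when $y=1/2$, so that there are always $2^n$ terms in total). Here $\zeta_n(s,a;\omega_1,\dots,\omega_n)$ is the Barnes zeta-function: for $\operatorname{Re}s>n$ it is the absolutely convergent series $\sum_{m_1,\dots,m_n\ge0}(a+\omega_1m_1+\cdots+\omega_nm_n)^{-s}$ with principal powers, and otherwise its meromorphic continuation in $s$ to $\mathbb C$. For the parameters above this continuation exists and is regular at $s=n-2p$. -/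

import Mathlib

open scoped Real

noncomputable section

/-- The primitive `2n`-th root of unity `η = e^{πi/n}`. -/
def etaRoot (n : ℕ) : ℂ := Complex.exp (π * Complex.I / n)

/-- `𝒵_h = ∑_{j=0}^{n-1} η^{j(1-h)}` for an integer `h`, with `η = e^{πi/n}`. -/
def zFactor (n : ℕ) (h : ℤ) : ℂ := ∑ j ∈ Finset.range n, etaRoot n ^ ((j : ℤ) * (1 - h))

/-- The summand `cos(2mπy) / m^{2p+1-n} · ∏_{j=1}^{n-1} cosh(2mπi η^j (y-1/2)) / sinh(mπi η^j)`. -/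
def seriesTerm (n : ℕ) (p : ℤ) (y : ℝ) (m : ℤ) : ℂ :=
  Complex.cos (2 * m * π * y) / (m : ℂ) ^ (2 * p + 1 - (n : ℤ)) *
    ∏ j ∈ Finset.Ico 1 n,
      Complex.cosh (2 * m * π * Complex.I * etaRoot n ^ j * (y - 1 / 2)) /
        Complex.sinh (m * π * Complex.I * etaRoot n ^ j)

/-- The finite set of all `(m_1, …, m_n)` of nonnegative integers with `m_1 + ⋯ + m_n = p`,
for an arbitrary integer `p`; it is empty if `p < 0`. -/
def compositionsOf (n : ℕ) (p : ℤ) : Finset (Fin n → ℕ) :=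
  if 0 ≤ p then Finset.piAntidiag Finset.univ p.toNat else ∅

theorem mem_compositionsOf {n : ℕ} {p : ℤ} {m : Fin n → ℕ} :
    m ∈ compositionsOf n p ↔ ((∑ j, m j : ℕ) : ℤ) = p := by
  unfold compositionsOf
  split_ifs with h
  · have hm : m ∈ Finset.piAntidiag Finset.univ p.toNat ↔ ∑ j, m j = p.toNat := by simp
    rw [hm]
    constructor
    · intro h1
      rw [h1, Int.toNat_of_nonneg h]
    · intro h1
      rw [← h1, Int.toNat_natCast]
  · constructor
    · intro h1
      exact absurd h1 (Finset.notMem_empty m)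
    · intro h1
      exact absurd (h1 ▸ Int.natCast_nonneg _) h

/-- `∑_{m_1+⋯+m_n=p} ∏_{ν=1}^n B_{2m_ν}(y)/(2m_ν)! · η^{2(ν-1)m_ν}`;
the index `ν : Fin n` here is `ν - 1` in this formula. -/
def bernoulliSum (n : ℕ) (p : ℤ) (y : ℝ) : ℂ :=
  ∑ m ∈ compositionsOf n p, ∏ ν : Fin n,
    ((bernoulliFun (2 * m ν) y : ℝ) : ℂ) / ((2 * m ν).factorial : ℂ) *
      etaRoot n ^ (2 * (ν : ℕ) * m ν)

/-- `Z` is the Barnes zeta-function `s ↦ ζ_n(s, a; ω_1, …, ω_n)` on all of `ℂ`: for `Re s > n` it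
is the sum of the (absolutely convergent) Dirichlet series
`∑_{m_1, …, m_n ≥ 0} (a + ω_1 m_1 + ⋯ + ω_n m_n)^{-s}`, with principal powers, and it is
meromorphic on `ℂ`. Normal form means that `Z` takes its analytic value wherever its singularity
is removable (and the value `0` at a pole). -/
def IsBarnesZeta {n : ℕ} (a : ℂ) (ω : Fin n → ℂ) (Z : ℂ → ℂ) : Prop :=
  MeromorphicNFOn Z Set.univ ∧
    ∀ s : ℂ, (n : ℝ) < s.re →
      HasSum (fun m : Fin n → ℕ => (a + ∑ j, ω j * (m j : ℂ)) ^ (-s)) (Z s)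

/-- The meromorphic continuation is unique. -/
theorem IsBarnesZeta.unique {n : ℕ} {a : ℂ} {ω : Fin n → ℂ} {Z₁ Z₂ : ℂ → ℂ}
    (h₁ : IsBarnesZeta a ω Z₁) (h₂ : IsBarnesZeta a ω Z₂) : Z₁ = Z₂ := by
  have hm : MeromorphicOn (Z₁ - Z₂) Set.univ := h₁.1.meromorphicOn.sub h₂.1.meromorphicOn
  have htop : meromorphicOrderAt (Z₁ - Z₂) ((n : ℂ) + 1) = ⊤ := by
    rw [meromorphicOrderAt_eq_top_iff]
    apply Filter.Eventually.filter_mono nhdsWithin_le_nhds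
    have ho : IsOpen {s : ℂ | (n : ℝ) < s.re} := isOpen_lt continuous_const Complex.continuous_re
    filter_upwards [ho.mem_nhds (show ((n : ℂ) + 1) ∈ {s : ℂ | (n : ℝ) < s.re} by simp)]
      with s hs
    simp [(h₁.2 s hs).unique (h₂.2 s hs)]
  funext x
  have hx : meromorphicOrderAt (Z₁ - Z₂) x = ⊤ := by
    by_contra hne
    exact hm.meromorphicOrderAt_ne_top_of_isPreconnected isPreconnected_univ
      (Set.mem_univ x) (Set.mem_univ _) hne htop
  rw [meromorphicOrderAt_eq_top_iff] at hx
  have he : Z₁ =ᶠ[nhdsWithin x {x}ᶜ] Z₂ := by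
    filter_upwards [hx] with s hs
    exact sub_eq_zero.mp hs
  exact ((MeromorphicNFAt.eventuallyEq_nhdsNE_iff_eventuallyEq_nhds
    (h₁.1 (Set.mem_univ x)) (h₂.1 (Set.mem_univ x))).1 he).eq_of_nhds

open Classical in
/-- The Barnes zeta-function `ζ_n(s, a; ω_1, …, ω_n)`, meromorphically continued to `ℂ`
(the value is `0` if there is no such continuation). -/
def barnesZeta {n : ℕ} (s a : ℂ) (ω : Fin n → ℂ) : ℂ :=
  if h : ∃ Z, IsBarnesZeta a ω Z then h.choose s else 0

/-- The periods `1, η, …, η^{n-1}`. -/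
def etaPeriods (n : ℕ) (j : Fin n) : ℂ := etaRoot n ^ (j : ℕ)

/-- The point `∑_{j=0}^{n-1} η^j y_j`, where `y_j = y` if `e j` is true and `y_j = 1 - y`
otherwise. -/
def etaShift (n : ℕ) (y : ℝ) (e : Fin n → Bool) : ℂ :=
  ∑ j : Fin n, etaRoot n ^ (j : ℕ) * (((if e j then y else 1 - y : ℝ)) : ℂ)

end

/-!
Put `E(t) = t cosh (t (y - 1/2)) / sinh (t / 2)`. This even function is the sum of the generating
functions `t e^{ty} / (e^t - 1)` of the Bernoulli polynomials at `y` and `1 - y`, so that its Taylor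
series at `0` is `2 ∑ B_{2k}(y) t^{2k} / (2k)!`. Everything is read off from the product
`G(t) = ∏_{j<n} E(η^j t)` (`bernoulliProd`). Its Taylor coefficient of order `2p` is `2^n` times the
sum over compositions of `p` (`coeff_taylorSeries_bernoulliProd`).

*The series.* The poles of `G` are at most simple and lie at the points `2πi m η^k` with
`m ≠ 0` and `0 ≤ k < n`. As `η^n = -1` and `E` is even, `G(η t) = G(t)`, so the
residues of `t^{-2p-1} G(t)` at the points with a given `m` differ only by powers of `η`; their sum
over `k` produces the factor `𝒵_{2p+1}` times the term of the series with index `m`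
(`residue_eq_seriesTerm`). The residue at `0` is the Taylor coefficient above. On the circles of
radius `2π (N + 1/2)` the integral of `t^{-2p-1} G(t)` tends to zero: for `0 < y < 1` each quotient
`cosh / sinh` decays exponentially in `|Re (η^j t)|`, and the two values `|Re t|`, `|Re (η t)|` cannot
both be small (`norm_bernoulliProd_le`); for `y ∈ {0, 1}` the quotients are bounded and `n < 2p`
makes the power of `t` decay. Hence the sum of all residues vanishes
(`zFactor_mul_tsum_seriesTerm`). The residue theorem is needed for simple poles only
(`circleIntegral_eq_sum_simple_poles`), after subtraction of a Taylor polynomial that does not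
contribute to the integral.

*The Barnes zeta-functions.* The periods `1, η, …, η^{n-1}` lie in an open half-plane, and a rotation
carries them to the right half-plane. There `Γ(s) ζ_n(s, a; ω)` is the Mellin transform of
`e^{-at} ∏ (1 - e^{-ω_j t})⁻¹`. Subtracting finitely many terms of the Laurent expansion at `0` on
`(0, 1]` continues the Mellin transform meromorphically (`mellinContinuation`), with a simple pole at
`-N` whose residue is the Laurent coefficient of `t^N`. This pole is cancelled by the zero of `1 / Γ`,
so that `ζ_n(-N, a; ω)` is `(-1)^N N!` times that coefficient (`exists_isBarnesZeta`). For
`a = ∑ η^j y_j` the kernel is a product of Bernoulli generating functions, and summing over all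
choices `y_j ∈ {y, 1 - y}` turns it into `G` (`sum_coeff_taylorSeries_bernoulliGen`).
-/

/-! ### Taylor coefficients of analytic functions as formal power series -/

/-- The Taylor series at `0` of a function `f : ℂ → ℂ`, as a formal power series. -/
noncomputable def taylorSeries (f : ℂ → ℂ) : PowerSeries ℂ :=
  PowerSeries.mk fun k => iteratedDeriv k f 0 / (k.factorial : ℂ)

theorem coeff_taylorSeries (f : ℂ → ℂ) (k : ℕ) :
    PowerSeries.coeff k (taylorSeries f) = iteratedDeriv k f 0 / (k.factorial : ℂ) := by
  simp [taylorSeries]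

theorem taylorSeries_mul {f g : ℂ → ℂ} (hf : AnalyticAt ℂ f 0) (hg : AnalyticAt ℂ g 0) :
    taylorSeries (fun z => f z * g z) = taylorSeries f * taylorSeries g := by
  ext k
  rw [PowerSeries.coeff_mul, coeff_taylorSeries,
    Finset.Nat.sum_antidiagonal_eq_sum_range_succ_mk]
  have h := iteratedDeriv_mul (n := k) (hf.contDiffAt (n := k)) (hg.contDiffAt (n := k))
  rw [show (fun z => f z * g z) = f * g from rfl, h, Finset.sum_div]
  refine Finset.sum_congr rfl fun i hi => ?_
  have hik : i ≤ k := by simpa [Nat.lt_succ_iff] using hi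
  rw [coeff_taylorSeries, coeff_taylorSeries, Nat.cast_choose ℂ hik]
  have h1 : (k.factorial : ℂ) ≠ 0 := by exact_mod_cast k.factorial_ne_zero
  have h2 : (i.factorial : ℂ) ≠ 0 := by exact_mod_cast i.factorial_ne_zero
  have h3 : ((k - i).factorial : ℂ) ≠ 0 := by exact_mod_cast (k - i).factorial_ne_zero
  field_simp

theorem taylorSeries_add {f g : ℂ → ℂ} (hf : AnalyticAt ℂ f 0) (hg : AnalyticAt ℂ g 0) :
    taylorSeries (fun z => f z + g z) = taylorSeries f + taylorSeries g := by
  ext k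
  rw [map_add, coeff_taylorSeries, coeff_taylorSeries, coeff_taylorSeries,
    show (fun z => f z + g z) = f + g from rfl,
    iteratedDeriv_add (hf.contDiffAt (n := k)) (hg.contDiffAt (n := k)), add_div]

theorem taylorSeries_const (c : ℂ) : taylorSeries (fun _ => c) = PowerSeries.C c := by
  ext k
  rw [coeff_taylorSeries, PowerSeries.coeff_C, iteratedDeriv_const]
  split_ifs with h <;> simp [h]

theorem taylorSeries_exp_mul (c : ℂ) :
    taylorSeries (fun z => Complex.exp (c * z)) = PowerSeries.rescale c (PowerSeries.exp ℂ) := by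
  ext k
  rw [coeff_taylorSeries, iteratedDeriv_cexp_const_mul, PowerSeries.coeff_rescale,
    PowerSeries.coeff_exp]
  simp [div_eq_mul_inv]

theorem taylorSeries_const_mul_id (c : ℂ) :
    taylorSeries (fun z => c * z) = PowerSeries.C c * PowerSeries.X := by
  rw [taylorSeries_mul (g := fun z => z) analyticAt_const analyticAt_id, taylorSeries_const]
  congr 1
  ext k
  rw [coeff_taylorSeries, iteratedDeriv_fun_id, PowerSeries.coeff_X]
  split_ifs with h1 h2 <;> simp_all

theorem taylorSeries_prod {ι : Type*} (s : Finset ι) {f : ι → ℂ → ℂ}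
    (hf : ∀ i ∈ s, AnalyticAt ℂ (f i) 0) :
    taylorSeries (fun z => ∏ i ∈ s, f i z) = ∏ i ∈ s, taylorSeries (f i) := by
  classical
  induction s using Finset.induction_on with
  | empty => simpa using taylorSeries_const 1
  | insert a s ha ih =>
    simp only [Finset.prod_insert ha]
    rw [taylorSeries_mul (hf a (Finset.mem_insert_self a s))
      (Finset.analyticAt_fun_prod s fun i hi => hf i (Finset.mem_insert_of_mem hi)),
      ih fun i hi => hf i (Finset.mem_insert_of_mem hi)]

theorem taylorSeries_sum {ι : Type*} (s : Finset ι) {f : ι → ℂ → ℂ}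
    (hf : ∀ i ∈ s, AnalyticAt ℂ (f i) 0) :
    taylorSeries (fun z => ∑ i ∈ s, f i z) = ∑ i ∈ s, taylorSeries (f i) := by
  classical
  induction s using Finset.induction_on with
  | empty => simpa using taylorSeries_const 0
  | insert a s ha ih =>
    simp only [Finset.sum_insert ha]
    rw [taylorSeries_add (hf a (Finset.mem_insert_self a s))
      (Finset.analyticAt_fun_sum s fun i hi => hf i (Finset.mem_insert_of_mem hi)),
      ih fun i hi => hf i (Finset.mem_insert_of_mem hi)]

/-- Taylor's formula with remainder `O(z ^ K)`. -/
theorem isBigO_sub_taylorSeries {f : ℂ → ℂ} (hf : AnalyticAt ℂ f 0) (K : ℕ) :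
    (fun z => f z - ∑ k ∈ Finset.range K, PowerSeries.coeff k (taylorSeries f) * z ^ k)
      =O[nhds 0] fun z => z ^ K := by
  have h := hf.hasFPowerSeriesAt.isBigO_sub_partialSum_pow K
  refine Asymptotics.IsBigO.of_norm_right ((h.congr_right fun z => (norm_pow z K).symm).congr_left
    fun z => ?_)
  simp [FormalMultilinearSeries.partialSum, coeff_taylorSeries, mul_comm, smul_eq_mul]

/-! ### The generating function of the Bernoulli polynomials -/

/-- The entire function `z ↦ (e^z - 1) / z`, with value `1` at `0`. -/
noncomputable def expSlope : ℂ → ℂ := dslope Complex.exp 0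

theorem mul_expSlope (z : ℂ) : z * expSlope z = Complex.exp z - 1 := by
  simpa [expSlope] using sub_smul_dslope Complex.exp 0 z

theorem expSlope_zero : expSlope 0 = 1 := by
  simp [expSlope, dslope_same]

theorem differentiable_expSlope : Differentiable ℂ expSlope := by
  rw [← differentiableOn_univ]
  exact (Complex.differentiableOn_dslope Filter.univ_mem).2
    Complex.differentiable_exp.differentiableOn

theorem expSlope_eq_zero_iff {z : ℂ} :
    expSlope z = 0 ↔ z ≠ 0 ∧ ∃ m : ℤ, z = m * (2 * π * Complex.I) := by
  rw [← Complex.exp_eq_one_iff, ← sub_eq_zero (b := (1 : ℂ)), ← mul_expSlope]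
  by_cases hz : z = 0
  · simp [hz, expSlope_zero]
  · simp [hz]

theorem expSlope_neg (z : ℂ) : Complex.exp z * expSlope (-z) = expSlope z := by
  by_cases hz : z = 0
  · simp [hz]
  · apply mul_left_cancel₀ hz
    have h := mul_expSlope (-z)
    have h2 : Complex.exp z * Complex.exp (-z) = 1 := by rw [← Complex.exp_add]; simp
    rw [mul_expSlope]
    linear_combination (-Complex.exp z) * h - h2

/-- The generating function `z ↦ z e^{yz} / (e^z - 1)` of the Bernoulli polynomials at `y`,
written so that it takes its analytic value at `z = 0`. -/
noncomputable def bernoulliGen (y z : ℂ) : ℂ := Complex.exp (y * z) / expSlope z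

theorem bernoulliGen_neg (y z : ℂ) : bernoulliGen y (-z) = bernoulliGen (1 - y) z := by
  unfold bernoulliGen
  rw [← expSlope_neg z, show (1 - y) * z = z + y * -z by ring, Complex.exp_add,
    mul_div_mul_left _ _ (Complex.exp_ne_zero z)]

theorem analyticAt_bernoulliGen (y : ℂ) {z : ℂ} (hz : expSlope z ≠ 0) :
    AnalyticAt ℂ (bernoulliGen y) z := by
  unfold bernoulliGen
  exact AnalyticAt.div (by fun_prop) (differentiable_expSlope.analyticAt z) hz

theorem analyticAt_bernoulliGen_mul (y c : ℂ) {z : ℂ} (hz : expSlope (c * z) ≠ 0) :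
    AnalyticAt ℂ (fun z => bernoulliGen y (c * z)) z :=
  (analyticAt_bernoulliGen y hz).comp (f := fun z => c * z) (by fun_prop)

theorem analyticAt_bernoulliGen_mul_zero (y c : ℂ) :
    AnalyticAt ℂ (fun z => bernoulliGen y (c * z)) 0 :=
  analyticAt_bernoulliGen_mul y c (by simp [expSlope_zero])

theorem meromorphicAt_bernoulliGen_mul (y c z : ℂ) :
    MeromorphicAt (fun z => bernoulliGen y (c * z)) z := by
  unfold bernoulliGen
  refine MeromorphicAt.div (AnalyticAt.meromorphicAt (by fun_prop)) (AnalyticAt.meromorphicAt ?_)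
  exact (differentiable_expSlope.comp (differentiable_id.const_mul c)).analyticAt z

theorem eventually_bernoulliGen_mul (y c : ℂ) : ∀ᶠ z in nhds (0 : ℂ),
    bernoulliGen y (c * z) * (Complex.exp (c * z) - 1) = c * z * Complex.exp (y * c * z) := by
  have h : ContinuousAt (fun z => expSlope (c * z)) 0 :=
    (differentiable_expSlope.continuous.comp (continuous_const.mul continuous_id)).continuousAt
  filter_upwards [h.eventually_ne (show expSlope (c * 0) ≠ 0 by simp [expSlope_zero])] with z hz
  rw [← mul_expSlope, bernoulliGen, mul_assoc y c z]
  field_simp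

theorem taylorSeries_congr {f g : ℂ → ℂ} (h : f =ᶠ[nhds 0] g) :
    taylorSeries f = taylorSeries g := by
  ext k
  rw [coeff_taylorSeries, coeff_taylorSeries, h.iteratedDeriv_eq]

theorem rescale_exp_sub_one_ne_zero {c : ℂ} (hc : c ≠ 0) :
    PowerSeries.rescale c (PowerSeries.exp ℂ) - 1 ≠ 0 := by
  intro h
  have := congrArg (PowerSeries.coeff 1) h
  simp [PowerSeries.coeff_rescale, PowerSeries.coeff_exp, PowerSeries.coeff_one, hc] at this

/-- The Taylor coefficients of `z ↦ bernoulliGen y (c * z)`. -/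
theorem coeff_taylorSeries_bernoulliGen (y : ℝ) {c : ℂ} (hc : c ≠ 0) (k : ℕ) :
    PowerSeries.coeff k (taylorSeries fun z => bernoulliGen y (c * z)) =
      ((bernoulliFun k y : ℝ) : ℂ) / (k.factorial : ℂ) * c ^ k := by
  have key : (taylorSeries fun z => bernoulliGen y (c * z)) =
      PowerSeries.rescale c (PowerSeries.mk fun n =>
        Polynomial.aeval (y : ℂ) ((1 / n.factorial : ℚ) • Polynomial.bernoulli n)) := by
    apply mul_right_cancel₀ (rescale_exp_sub_one_ne_zero hc)
    have h1 := congrArg (PowerSeries.rescale c)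
      (Polynomial.bernoulli_generating_function (A := ℂ) (y : ℂ))
    rw [map_mul, map_mul, map_sub, map_one, PowerSeries.rescale_rescale,
      PowerSeries.rescale_X] at h1
    rw [h1]
    have h2 := taylorSeries_congr (eventually_bernoulliGen_mul y c)
    have ha : AnalyticAt ℂ (fun z => Complex.exp (c * z)) 0 := by fun_prop
    rw [taylorSeries_mul (g := fun z => Complex.exp (c * z) - 1)
      (analyticAt_bernoulliGen_mul_zero y c) (by fun_prop), taylorSeries_mul (by fun_prop) (by fun_prop),
      taylorSeries_const_mul_id, taylorSeries_exp_mul] at h2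
    have h3 : (taylorSeries fun z => Complex.exp (c * z) - 1) =
        PowerSeries.rescale c (PowerSeries.exp ℂ) - 1 := by
      simp only [sub_eq_add_neg]
      rw [taylorSeries_add ha analyticAt_const, taylorSeries_exp_mul, taylorSeries_const]
      simp
    rw [h3] at h2
    rw [h2]
  rw [key, PowerSeries.coeff_rescale, PowerSeries.coeff_mk, mul_comm]
  congr 1
  rw [map_smul, bernoulliFun, ← Complex.coe_algebraMap, Polynomial.aeval_algebraMap_apply, 
    Polynomial.eval_map_algebraMap, Algebra.smul_def]
  simp [div_eq_mul_inv, mul_comm]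

/-! ### A residue theorem for simple poles in a disc -/

/-- The residue theorem for a disc, for a function with finitely many (at most) simple poles. -/
theorem circleIntegral_eq_sum_simple_poles {ι : Type*} {F : ℂ → ℂ} {x : ℂ} {R : ℝ} (hR : 0 ≤ R)
    (s : Finset ι) (w c : ι → ℂ) (hinj : Set.InjOn w s)
    (hw : ∀ i ∈ s, w i ∈ Metric.ball x R)
    (hF : ∀ z ∈ Metric.closedBall x R, (∀ i ∈ s, z ≠ w i) → AnalyticAt ℂ F z)
    (hmer : ∀ i ∈ s, MeromorphicAt F (w i))
    (hres : ∀ i ∈ s, Filter.Tendsto (fun z => (z - w i) * F z) (nhdsWithin (w i) {w i}ᶜ)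
      (nhds (c i))) :
    (∮ z in C(x, R), F z) = 2 * π * Complex.I * ∑ i ∈ s, c i := by
  classical
  set P : ℂ → ℂ := fun z => ∑ i ∈ s, c i * (z - w i)⁻¹ with hP
  set K : ℂ → ℂ := fun z => F z - P z with hK
  have hterm : ∀ i z, z ≠ w i → AnalyticAt ℂ (fun z => c i * (z - w i)⁻¹) z := fun i z hz =>
    analyticAt_const.mul (AnalyticAt.inv (by fun_prop) (sub_ne_zero.2 hz))
  have hPan : ∀ z, (∀ i ∈ s, z ≠ w i) → AnalyticAt ℂ P z := fun z hz =>
    Finset.analyticAt_fun_sum s fun i hi => hterm i z (hz i hi)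
  have hPmer : ∀ z, MeromorphicAt P z := fun z =>
    MeromorphicAt.fun_sum fun i _ => (MeromorphicAt.const _ _).mul
      (MeromorphicAt.inv (f := fun z => z - w i) (x := z)
        (AnalyticAt.meromorphicAt (by fun_prop)))
  have hKan : ∀ z ∈ Metric.closedBall x R, (∀ i ∈ s, z ≠ w i) → AnalyticAt ℂ K z :=
    fun z hz h => (hF z hz h).sub (hPan z h)
  have hKmer : MeromorphicOn K (Metric.closedBall x R) := by
    intro z hz
    by_cases h : ∀ i ∈ s, z ≠ w i
    · exact (hKan z hz h).meromorphicAt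
    · push Not at h
      obtain ⟨i, hi, rfl⟩ := h
      exact (hmer i hi).sub (hPmer _)
  have hord : ∀ z ∈ Metric.closedBall x R, 0 ≤ meromorphicOrderAt K z := by
    intro z hz
    by_cases h : ∀ i ∈ s, z ≠ w i
    · exact (hKan z hz h).meromorphicOrderAt_nonneg
    push Not at h
    obtain ⟨i, hi, rfl⟩ := h
    have hlim : Filter.Tendsto (fun z => (z - w i) * K z) (nhdsWithin (w i) {w i}ᶜ) (nhds 0) := by
      -- only the term with index `i` of the principal part has a pole at `w i`
      have hrest : Filter.Tendsto
          (fun z => (z - w i) * ∑ k ∈ s.erase i, c k * (z - w k)⁻¹)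
          (nhdsWithin (w i) {w i}ᶜ) (nhds 0) := by
        have hc : ContinuousAt (fun z => (z - w i) * ∑ k ∈ s.erase i, c k * (z - w k)⁻¹) (w i) := by
          refine ContinuousAt.mul (by fun_prop) (AnalyticAt.continuousAt (𝕜 := ℂ) ?_)
          refine Finset.analyticAt_fun_sum _ fun k hk => hterm k _ fun he => ?_
          exact (Finset.mem_erase.1 hk).1 (hinj (Finset.mem_erase.1 hk).2 hi he.symm)
        simpa using hc.tendsto.mono_left nhdsWithin_le_nhds
      have h1 := ((hres i hi).sub (tendsto_const_nhds (x := c i))).sub hrest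
      rw [sub_self, sub_zero] at h1
      refine h1.congr' ?_
      filter_upwards [self_mem_nhdsWithin] with z hz
      have hz' : z - w i ≠ 0 := sub_ne_zero.2 hz
      rw [hK, hP]
      simp only
      rw [← Finset.add_sum_erase s _ hi]
      field_simp
      ring
    have hm1 : MeromorphicAt (fun z => z - w i) (w i) := AnalyticAt.meromorphicAt (by fun_prop)
    have hpos := (tendsto_zero_iff_meromorphicOrderAt_pos (hm1.mul (hKmer _ hz))).1 hlim
    rw [meromorphicOrderAt_mul hm1 (hKmer _ hz)] at hpos
    have h1 : meromorphicOrderAt (fun z => z - w i) (w i) = 1 := by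
      rw [show (1 : WithTop ℤ) = ((1 : ℤ) : WithTop ℤ) from rfl, meromorphicOrderAt_eq_int_iff hm1]
      exact ⟨fun _ => 1, analyticAt_const, one_ne_zero, by simp⟩
    rw [h1] at hpos
    cases ho : meromorphicOrderAt K (w i) with
    | top => exact le_top
    | coe m =>
      rw [ho] at hpos
      have : (0 : ℤ) < 1 + m := by exact_mod_cast hpos
      exact_mod_cast (by omega : (0 : ℤ) ≤ m)
  set L := toMeromorphicNFOn K (Metric.closedBall x R) with hL
  have hLan : ∀ z ∈ Metric.closedBall x R, AnalyticAt ℂ L z := by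
    intro z hz
    have hnf := meromorphicNFOn_toMeromorphicNFOn K (Metric.closedBall x R) hz
    rw [← hnf.meromorphicOrderAt_nonneg_iff_analyticAt,
      meromorphicOrderAt_toMeromorphicNFOn hKmer hz]
    exact hord z hz
  have hsph : ∀ z ∈ Metric.sphere x R, ∀ i ∈ s, z ≠ w i := by
    rintro z hz i hi rfl
    have h1 := hw i hi
    rw [Metric.mem_ball] at h1
    rw [Metric.mem_sphere] at hz
    exact absurd hz h1.ne
  have hLK : Set.EqOn K L (Metric.sphere x R) := by
    intro z hz
    have hz' := Metric.sphere_subset_closedBall hz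
    have := toMeromorphicNFOn_eq_toMeromorphicNFAt hKmer hz'
    rw [hL, this, toMeromorphicNFAt_eq_self.2 (hKan z hz' (hsph z hz)).meromorphicNFAt]
  have hzero : (∮ z in C(x, R), K z) = 0 := by
    rw [circleIntegral.integral_congr hR hLK]
    exact Complex.circleIntegral_eq_zero_of_differentiable_on_off_countable hR
      Set.countable_empty (fun z hz => (hLan z hz).continuousAt.continuousWithinAt)
      (fun z hz => (hLan z (Metric.ball_subset_closedBall hz.1)).differentiableAt)
  have hKint : CircleIntegrable K x R :=
    ContinuousOn.circleIntegrable hR fun z hz => (hKan z (Metric.sphere_subset_closedBall hz)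
      (hsph z hz)).continuousAt.continuousWithinAt
  have htint : ∀ i ∈ s, CircleIntegrable (fun z => c i * (z - w i)⁻¹) x R := fun i hi =>
    ContinuousOn.circleIntegrable hR fun z hz =>
      (hterm i z (hsph z hz i hi)).continuousAt.continuousWithinAt
  have hPint : CircleIntegrable P x R :=
    ContinuousOn.circleIntegrable hR fun z hz =>
      (hPan z (hsph z hz)).continuousAt.continuousWithinAt
  calc (∮ z in C(x, R), F z) = ∮ z in C(x, R), (K z + P z) := by simp [hK]
    _ = ∮ z in C(x, R), P z := by rw [circleIntegral.integral_add hKint hPint, hzero, zero_add]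
    _ = ∑ i ∈ s, c i * (2 * π * Complex.I) := by
        rw [hP, circleIntegral.integral_fun_sum htint]
        refine Finset.sum_congr rfl fun i hi => ?_
        rw [circleIntegral.integral_const_mul, circleIntegral.integral_sub_inv_of_mem_ball (hw i hi)]
    _ = _ := by rw [← Finset.sum_mul, mul_comm]

/-! ### Estimates for hyperbolic functions -/

theorem Complex.norm_sinh_sq (z : ℂ) :
    ‖Complex.sinh z‖ ^ 2 = Real.sinh z.re ^ 2 + Real.sin z.im ^ 2 := by
  have h : Complex.sinh z = ((Real.sinh z.re * Real.cos z.im : ℝ) : ℂ) +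
      ((Real.cosh z.re * Real.sin z.im : ℝ) : ℂ) * Complex.I := by
    conv_lhs => rw [← Complex.re_add_im z]
    rw [Complex.sinh_add, Complex.sinh_mul_I, Complex.cosh_mul_I]
    push_cast
    ring
  rw [Complex.sq_norm, h, Complex.normSq_add_mul_I]
  have h1 := Real.cosh_sq z.re
  have h2 := Real.sin_sq_add_cos_sq z.im
  linear_combination Real.sin z.im ^ 2 * h1 + Real.sinh z.re ^ 2 * h2

theorem Complex.norm_cosh_le (z : ℂ) : ‖Complex.cosh z‖ ≤ Real.exp |z.re| := by
  rw [Complex.cosh, norm_div, Complex.norm_ofNat]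
  have h := norm_add_le (Complex.exp z) (Complex.exp (-z))
  rw [Complex.norm_exp, Complex.norm_exp, Complex.neg_re] at h
  have h1 : Real.exp z.re ≤ Real.exp |z.re| := Real.exp_le_exp.2 (le_abs_self _)
  have h2 : Real.exp (-z.re) ≤ Real.exp |z.re| := Real.exp_le_exp.2 (neg_le_abs _)
  linarith

theorem abs_sinh_re_le_norm_sinh (z : ℂ) : |Real.sinh z.re| ≤ ‖Complex.sinh z‖ :=
  abs_le_of_sq_le_sq' (by rw [Complex.norm_sinh_sq]; nlinarith [sq_nonneg (Real.sin z.im)])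
    (norm_nonneg _) |> abs_le.2

theorem abs_sin_im_le_norm_sinh (z : ℂ) : |Real.sin z.im| ≤ ‖Complex.sinh z‖ :=
  abs_le_of_sq_le_sq' (by rw [Complex.norm_sinh_sq]; nlinarith [sq_nonneg (Real.sinh z.re)])
    (norm_nonneg _) |> abs_le.2

/-- Away from the imaginary axis, `‖sinh z‖` is comparable to `e^{|Re z|}`. -/
theorem exp_abs_re_le_norm_sinh {x : ℝ} {z : ℂ} (hz : x ≤ |z.re|) :
    (1 - Real.exp (-(2 * x))) / 2 * Real.exp |z.re| ≤ ‖Complex.sinh z‖ := by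
  refine le_trans ?_ (abs_sinh_re_le_norm_sinh z)
  rw [Real.abs_sinh, Real.sinh_eq]
  have h : Real.exp (-|z.re|) ≤ Real.exp (-(2 * x)) * Real.exp |z.re| := by
    rw [← Real.exp_add]
    exact Real.exp_le_exp.2 (by linarith)
  linarith

/-- On the circles of radius `π (N + 1/2)`, which stay away from the zeros of `sinh`,
`‖sinh z‖` is comparable to `e^{|Re z|}`. -/
theorem exp_abs_re_le_norm_sinh_of_norm_eq {N : ℕ} {z : ℂ} (hz : ‖z‖ = π * (N + 1 / 2)) :
    1 / 8 * Real.exp |z.re| ≤ ‖Complex.sinh z‖ := by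
  rcases le_or_gt 1 |z.re| with h | h
  · refine le_trans ?_ (exp_abs_re_le_norm_sinh h)
    have h1 : Real.exp (-(2 * 1)) ≤ 1 / 2 := by
      rw [Real.exp_neg]
      have := Real.add_one_le_exp (2 * 1 : ℝ)
      rw [one_div]
      exact inv_anti₀ (by norm_num) (by linarith)
    have := Real.exp_pos |z.re|
    nlinarith
  · refine le_trans ?_ (abs_sin_im_le_norm_sinh z)
    have h1 : ‖z‖ ≤ |z.re| + |z.im| := Complex.norm_le_abs_re_add_abs_im z
    have h2 : |z.im| ≤ ‖z‖ := Complex.abs_im_le_norm z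
    set d : ℝ := π * (N + 1 / 2) - |z.im| with hd
    have hd0 : 0 ≤ d := by rw [hd, ← hz]; linarith
    have hd1 : d ≤ 1 := by rw [hd, ← hz]; linarith
    have h3 : |Real.sin z.im| = |Real.cos d| := by
      have h4 : |Real.sin z.im| = |Real.sin (|z.im|)| := by
        rcases abs_cases z.im with ⟨h, _⟩ | ⟨h, _⟩ <;> simp [h]
      have h5 : |z.im| = (π / 2 - d) + N * π := by rw [hd]; ring
      rw [h4, h5, Real.sin_add_nat_mul_pi, abs_mul, abs_pow, abs_neg, abs_one, one_pow, one_mul,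
        Real.sin_pi_div_two_sub]
    have h6 : 1 / 2 ≤ Real.cos d := by
      have := Real.one_sub_sq_div_two_le_cos (x := d)
      nlinarith
    have h7 : Real.exp |z.re| ≤ 4 := by
      have := Real.exp_one_lt_d9
      exact (Real.exp_le_exp.2 h.le).trans (by linarith)
    rw [h3, abs_of_nonneg (a := Real.cos d) (by linarith)]
    linarith

/-- The quotient `cosh (t (y - 1/2)) / sinh (t / 2)` decays exponentially in `|Re t|` for
`0 < y < 1`, wherever `sinh` has its typical size. -/
theorem norm_cosh_div_sinh_le {y c : ℝ} {t : ℂ} (hc : 0 < c)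
    (h : c * Real.exp |(t / 2).re| ≤ ‖Complex.sinh (t / 2)‖) :
    ‖Complex.cosh (t * (y - 1 / 2)) / Complex.sinh (t / 2)‖ ≤
      c⁻¹ * Real.exp (-((1 / 2 - |y - 1 / 2|) * |t.re|)) := by
  have h1 := Complex.norm_cosh_le (t * (y - 1 / 2))
  have hre : (t * (y - 1 / 2)).re = t.re * (y - 1 / 2) := by
    rw [show ((y : ℂ) - 1 / 2) = ((y - 1 / 2 : ℝ) : ℂ) by push_cast; ring, Complex.re_mul_ofReal]
  have hre2 : (t / 2).re = t.re / 2 := by simp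
  rw [hre, abs_mul] at h1
  rw [hre2, abs_div, abs_two] at h
  have hpos : 0 < c * Real.exp (|t.re| / 2) := by positivity
  rw [norm_div]
  calc _ ≤ Real.exp (|t.re| * |y - 1 / 2|) / (c * Real.exp (|t.re| / 2)) :=
        div_le_div₀ (Real.exp_pos _).le h1 hpos h
    _ = _ := by
        rw [div_mul_eq_div_div_swap, ← Real.exp_sub, div_eq_inv_mul]
        congr 2
        ring

/-- Powers are dominated by exponentials; both sources of decay give at least `x ^ (-2)`. -/
theorem exists_zpow_mul_exp_le {a : ℤ} {c : ℝ} (hc : 0 < c ∨ (c = 0 ∧ a ≤ -2)) :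
    ∃ B : ℝ, ∀ x : ℝ, 1 ≤ x → x ^ a * Real.exp (-(c * x)) ≤ B * x ^ (-2 : ℤ) := by
  rcases hc with hc | ⟨rfl, ha⟩
  · set k : ℕ := (a + 2).toNat with hk
    refine ⟨k.factorial / c ^ k, fun x hx => ?_⟩
    have hx0 : 0 < x := by linarith
    have h1 := Real.pow_div_factorial_le_exp (c * x) (by positivity) k
    have h2 : x ^ a ≤ x ^ k * x ^ (-2 : ℤ) := by
      rw [← zpow_natCast x k, ← zpow_add₀ hx0.ne']
      exact zpow_le_zpow_right₀ hx (by omega)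
    have h3 : x ^ k * Real.exp (-(c * x)) ≤ k.factorial / c ^ k := by
      rw [Real.exp_neg, ← div_eq_mul_inv, div_le_div_iff₀ (Real.exp_pos _) (by positivity)]
      rw [div_le_iff₀ (by positivity), mul_pow] at h1
      linarith
    calc x ^ a * Real.exp (-(c * x)) ≤ x ^ k * x ^ (-2 : ℤ) * Real.exp (-(c * x)) := by gcongr
      _ = x ^ k * Real.exp (-(c * x)) * x ^ (-2 : ℤ) := by ring
      _ ≤ _ := by gcongr
  · refine ⟨1, fun x hx => ?_⟩
    simpa using zpow_le_zpow_right₀ hx ha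

theorem abs_im_mul_norm_le {e t : ℂ} (he : ‖e‖ = 1) :
    |e.im| / 2 * ‖t‖ ≤ |t.re| + |(e * t).re| := by
  have h1 : ‖t‖ ≤ |t.re| + |t.im| := Complex.norm_le_abs_re_add_abs_im t
  have h2 : |e.im| ≤ 1 := he ▸ Complex.abs_im_le_norm e
  have h3 : |e.re| ≤ 1 := he ▸ Complex.abs_re_le_norm e
  have h4 : |e.im| * |t.im| ≤ |t.re| + |(e * t).re| := by
    rw [← abs_mul, show e.im * t.im = e.re * t.re - (e * t).re by rw [Complex.mul_re]; ring]
    refine (abs_sub _ _).trans ?_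
    rw [abs_mul]
    nlinarith [abs_nonneg t.re]
  nlinarith [abs_nonneg t.re, abs_nonneg (e * t).re, abs_nonneg e.im, abs_nonneg t.im]

/-! ### The symmetrized generating function -/

/-- The even meromorphic function `t ↦ t cosh (t (y - 1/2)) / sinh (t / 2)`, as the sum of the
generating functions of the Bernoulli polynomials at `y` and `1 - y`. -/
noncomputable def bernoulliSym (y z : ℂ) : ℂ := bernoulliGen y z + bernoulliGen (1 - y) z

theorem bernoulliSym_neg (y z : ℂ) : bernoulliSym y (-z) = bernoulliSym y z := by
  rw [bernoulliSym, bernoulliSym, bernoulliGen_neg, bernoulliGen_neg, sub_sub_cancel, add_comm]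

theorem bernoulliSym_eq (y : ℂ) {t : ℂ} (ht : t ≠ 0) :
    bernoulliSym y t = t * (Complex.cosh (t * (y - 1 / 2)) / Complex.sinh (t / 2)) := by
  have h1 : expSlope t = Complex.exp (t / 2) * (2 * Complex.sinh (t / 2)) / t := by
    rw [eq_div_iff ht, mul_comm, mul_expSlope, Complex.two_sinh, mul_sub, ← Complex.exp_add,
      ← Complex.exp_add]
    simp
  have h2 : Complex.exp (y * t) + Complex.exp ((1 - y) * t) =
      Complex.exp (t / 2) * (2 * Complex.cosh (t * (y - 1 / 2))) := by
    rw [Complex.two_cosh, mul_add, ← Complex.exp_add, ← Complex.exp_add]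
    congr 2 <;> ring
  rw [bernoulliSym, bernoulliGen, bernoulliGen, ← add_div, h1, h2, div_div_eq_mul_div, mul_assoc,
    mul_div_mul_left _ _ (Complex.exp_ne_zero _), mul_assoc, mul_div_mul_left _ _ two_ne_zero]
  ring

theorem analyticAt_bernoulliSym_mul (y c : ℂ) {z : ℂ} (hz : expSlope (c * z) ≠ 0) :
    AnalyticAt ℂ (fun z => bernoulliSym y (c * z)) z :=
  (analyticAt_bernoulliGen_mul y c hz).add (analyticAt_bernoulliGen_mul (1 - y) c hz)

/-- `bernoulliSym y` has at most a simple pole at `t = 2πim`, with residue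
`2 t cosh (t (y - 1/2)) / cosh (t / 2) = 2 t cos (2πmy)`. -/
theorem tendsto_sub_mul_bernoulliSym (y : ℂ) {m : ℤ} (hm : m ≠ 0) :
    Filter.Tendsto (fun z => (z - m * (2 * π * Complex.I)) * bernoulliSym y z)
      (nhdsWithin (m * (2 * π * Complex.I)) {m * (2 * π * Complex.I)}ᶜ)
      (nhds (m * (2 * π * Complex.I) * (2 * Complex.cos (2 * m * π * y)))) := by
  set t : ℂ := m * (2 * π * Complex.I) with ht
  have ht0 : t ≠ 0 := by
    rw [ht]
    exact mul_ne_zero (by exact_mod_cast hm) Complex.two_pi_I_ne_zero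
  have hexp : Complex.exp t = 1 := Complex.exp_eq_one_iff.2 ⟨m, rfl⟩
  have hslope : HasDerivAt expSlope t⁻¹ t := by
    have h : HasDerivAt (fun z => (Complex.exp z - 1) / z) t⁻¹ t := by
      refine HasDerivAt.congr_deriv
        (((Complex.hasDerivAt_exp t).sub_const 1).div (hasDerivAt_id t) ht0) ?_
      simp only [hexp]
      field_simp
      simp
    refine h.congr_of_eventuallyEq ?_
    filter_upwards [isOpen_ne.mem_nhds ht0] with z hz
    rw [eq_div_iff hz, mul_comm, mul_expSlope]
  have h0 : expSlope t = 0 := expSlope_eq_zero_iff.2 ⟨ht0, m, rfl⟩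
  have h1 := (hasDerivAt_iff_tendsto_slope.1 hslope).inv₀ (inv_ne_zero ht0)
  rw [inv_inv] at h1
  have hc : Filter.Tendsto (fun z => Complex.exp (y * z) + Complex.exp ((1 - y) * z))
      (nhdsWithin t {t}ᶜ) (nhds (Complex.exp (y * t) + Complex.exp ((1 - y) * t))) :=
    (Continuous.tendsto (by fun_prop) t).mono_left nhdsWithin_le_nhds
  have h2 : Complex.exp (y * t) + Complex.exp ((1 - y) * t) = 2 * Complex.cos (2 * m * π * y) := by
    rw [show (1 - y) * t = t + -(y * t) by ring, Complex.exp_add, hexp, one_mul, Complex.two_cos]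
    congr 2 <;> rw [ht] <;> ring
  rw [← h2]
  refine (h1.mul hc).congr fun z => ?_
  rw [slope_def_field, h0, bernoulliSym, bernoulliGen, bernoulliGen]
  simp only [sub_zero, inv_div]
  ring

/-! ### The root of unity `η` -/

theorem etaRoot_ne_zero (n : ℕ) : etaRoot n ≠ 0 := Complex.exp_ne_zero _

theorem etaRoot_pow_eq (n j : ℕ) :
    etaRoot n ^ j = Complex.exp (((π * j / n : ℝ) : ℂ) * Complex.I) := by
  rw [etaRoot, ← Complex.exp_nat_mul]
  congr 1
  push_cast
  ring

theorem norm_etaRoot_pow (n j : ℕ) : ‖etaRoot n ^ j‖ = 1 := by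
  rw [etaRoot_pow_eq, Complex.norm_exp_ofReal_mul_I]

theorem etaRoot_pow_self {n : ℕ} (hn : n ≠ 0) : etaRoot n ^ n = -1 := by
  have : (n : ℝ) ≠ 0 := by exact_mod_cast hn
  rw [etaRoot_pow_eq, mul_div_assoc, div_self this, mul_one, Complex.exp_pi_mul_I]

theorem etaRoot_pow_im_pos {n j : ℕ} (hj : 1 ≤ j) (hjn : j < n) : 0 < (etaRoot n ^ j).im := by
  rw [etaRoot_pow_eq, Complex.exp_ofReal_mul_I_im]
  have hn : (0 : ℝ) < n := by exact_mod_cast (by omega : 0 < n)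
  have hj' : (0 : ℝ) < j := by exact_mod_cast hj
  have hjn' : (j : ℝ) < n := by exact_mod_cast hjn
  apply Real.sin_pos_of_pos_of_lt_pi
  · positivity
  · rw [div_lt_iff₀ hn]
    exact mul_lt_mul_of_pos_left hjn' Real.pi_pos

theorem prod_etaRoot_pow (n : ℕ) :
    ∏ j ∈ Finset.range n, etaRoot n ^ j = etaRoot n ^ (n * (n - 1) / 2) := by
  rw [Finset.prod_pow_eq_pow_sum, Finset.sum_range_id]

/-- The points `2πi m η^k` with `m ≠ 0` and `0 ≤ k < n` are distinct. -/
theorem mul_etaRoot_pow_injOn (n : ℕ) :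
    Set.InjOn (fun i : ℤ × ℕ => i.1 * (2 * π * Complex.I) * etaRoot n ^ i.2)
      {i | i.1 ≠ 0 ∧ i.2 < n} := by
  -- if `m η^k = l η^j` with `k ≤ j`, then `η^(j-k)` is real, and so `j = k`
  have key : ∀ (m l : ℤ) (k j : ℕ), l ≠ 0 → j < n → k ≤ j →
      (m : ℂ) * etaRoot n ^ k = l * etaRoot n ^ j → m = l ∧ k = j := by
    intro m l k j hl hj hkj h
    have h1 : (m : ℂ) = l * etaRoot n ^ (j - k) := by
      apply mul_right_cancel₀ (pow_ne_zero k (etaRoot_ne_zero n))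
      rw [h, mul_assoc, ← pow_add, Nat.sub_add_cancel hkj]
    have h2 : j - k = 0 := by
      by_contra hne
      have h3 := congrArg Complex.im h1
      rw [show ((l : ℂ)) = ((l : ℝ) : ℂ) by simp, Complex.im_ofReal_mul, Complex.intCast_im] at h3
      have h4 := etaRoot_pow_im_pos (n := n) (j := j - k) (by omega) (by omega)
      exact (mul_ne_zero (by exact_mod_cast hl) h4.ne') h3.symm
    refine ⟨?_, by omega⟩
    rw [h2, pow_zero, mul_one] at h1
    exact_mod_cast h1
  rintro ⟨m, k⟩ ⟨hm, hk⟩ ⟨l, j⟩ ⟨hl, hj⟩ h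
  simp only at hm hk hl hj h
  have h' : (m : ℂ) * etaRoot n ^ k = l * etaRoot n ^ j := by
    apply mul_left_cancel₀ Complex.two_pi_I_ne_zero
    linear_combination h
  rcases le_total k j with hkj | hkj
  · obtain ⟨rfl, rfl⟩ := key m l k j hl hj hkj h'
    rfl
  · obtain ⟨rfl, rfl⟩ := key l m j k hm hk hkj h'.symm
    rfl

/-! ### The product over the rotations by powers of `η` -/

/-- The function `t ↦ ∏_{j<n} η^j t cosh (η^j t (y - 1/2)) / sinh (η^j t / 2)`, whose poles are the
points `2πi m η^k` with `m ≠ 0`. -/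
noncomputable def bernoulliProd (n : ℕ) (y : ℝ) (z : ℂ) : ℂ :=
  ∏ j ∈ Finset.range n, bernoulliSym y (etaRoot n ^ j * z)

theorem bernoulliProd_eq_mul {n : ℕ} (hn : n ≠ 0) (y : ℝ) (z : ℂ) :
    bernoulliProd n y z =
      bernoulliSym y z * ∏ j ∈ Finset.Ico 1 n, bernoulliSym y (etaRoot n ^ j * z) := by
  rw [bernoulliProd, Finset.range_eq_Ico, Finset.prod_eq_prod_Ico_succ_bot (by omega)]
  simp

theorem bernoulliProd_etaRoot_mul {n : ℕ} (hn : n ≠ 0) (y : ℝ) (z : ℂ) :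
    bernoulliProd n y (etaRoot n * z) = bernoulliProd n y z := by
  -- the factor with index `n` is the one with index `0`, as `η^n = -1`
  obtain ⟨k, rfl⟩ := Nat.exists_eq_succ_of_ne_zero hn
  rw [bernoulliProd, bernoulliProd, Finset.prod_range_succ, Finset.prod_range_succ']
  congr 1
  · exact Finset.prod_congr rfl fun j _ => by rw [pow_succ, mul_assoc]
  · rw [← mul_assoc, ← pow_succ, etaRoot_pow_self hn, neg_one_mul, bernoulliSym_neg, pow_zero,
      one_mul]

theorem bernoulliProd_etaRoot_pow_mul {n : ℕ} (hn : n ≠ 0) (y : ℝ) (k : ℕ) (z : ℂ) :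
    bernoulliProd n y (etaRoot n ^ k * z) = bernoulliProd n y z := by
  induction k with
  | zero => simp
  | succ k ih => rw [pow_succ', mul_assoc, bernoulliProd_etaRoot_mul hn, ih]

theorem meromorphicAt_bernoulliProd (n : ℕ) (y : ℝ) (z : ℂ) :
    MeromorphicAt (bernoulliProd n y) z :=
  MeromorphicAt.fun_prod fun _ _ =>
    (meromorphicAt_bernoulliGen_mul _ _ z).add (meromorphicAt_bernoulliGen_mul _ _ z)

theorem analyticAt_bernoulliProd {n : ℕ} (y : ℝ) {z : ℂ}
    (hz : ∀ m : ℤ, m ≠ 0 → ∀ k < n, z ≠ m * (2 * π * Complex.I) * etaRoot n ^ k) :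
    AnalyticAt ℂ (bernoulliProd n y) z := by
  refine Finset.analyticAt_fun_prod _ fun j hj => analyticAt_bernoulliSym_mul _ _ fun h => ?_
  have hjn := Finset.mem_range.1 hj
  obtain ⟨h0, m, hm⟩ := expSlope_eq_zero_iff.1 h
  have hm0 : m ≠ 0 := by
    rintro rfl
    exact h0 (by simpa using hm)
  rcases Nat.eq_zero_or_pos j with rfl | hj0
  · exact hz m hm0 0 hjn (by simpa using hm)
  · refine hz (-m) (neg_ne_zero.2 hm0) (n - j) (by omega) ?_
    apply mul_left_cancel₀ (pow_ne_zero j (etaRoot_ne_zero n))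
    have h1 : etaRoot n ^ j * etaRoot n ^ (n - j) = -1 := by
      rw [← pow_add, Nat.add_sub_cancel' hjn.le, etaRoot_pow_self (by omega)]
    rw [hm]
    push_cast
    linear_combination (m * (2 * π * Complex.I)) * h1

theorem analyticAt_bernoulliProd_zero (n : ℕ) (y : ℝ) : AnalyticAt ℂ (bernoulliProd n y) 0 :=
  Finset.analyticAt_fun_prod _ fun j _ =>
    analyticAt_bernoulliSym_mul _ _ (by simp [expSlope_zero])

/-- The residue of `bernoulliProd n y` at the pole `2πi m η^k`. -/
theorem tendsto_sub_mul_bernoulliProd {n : ℕ} (hn : n ≠ 0) (y : ℝ) {m : ℤ} (hm : m ≠ 0) (k : ℕ) :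
    Filter.Tendsto
      (fun z => (z - m * (2 * π * Complex.I) * etaRoot n ^ k) * bernoulliProd n y z)
      (nhdsWithin (m * (2 * π * Complex.I) * etaRoot n ^ k)
        {m * (2 * π * Complex.I) * etaRoot n ^ k}ᶜ)
      (nhds (etaRoot n ^ k * (m * (2 * π * Complex.I) * (2 * Complex.cos (2 * m * π * y)) *
        ∏ j ∈ Finset.Ico 1 n, bernoulliSym y (etaRoot n ^ j * (m * (2 * π * Complex.I)))))) := by
  set t : ℂ := m * (2 * π * Complex.I) with ht
  have he : etaRoot n ^ k ≠ 0 := pow_ne_zero k (etaRoot_ne_zero n)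
  have h1 : Filter.Tendsto (fun z => (z - t) * bernoulliProd n y z) (nhdsWithin t {t}ᶜ)
      (nhds (t * (2 * Complex.cos (2 * m * π * y)) *
        ∏ j ∈ Finset.Ico 1 n, bernoulliSym y (etaRoot n ^ j * t))) := by
    have hc : ContinuousAt (fun z => ∏ j ∈ Finset.Ico 1 n, bernoulliSym y (etaRoot n ^ j * z)) t := by
      refine AnalyticAt.continuousAt (𝕜 := ℂ) (Finset.analyticAt_fun_prod _ fun j hj =>
        analyticAt_bernoulliSym_mul _ _ fun h => ?_)
      obtain ⟨hj1, hjn⟩ := Finset.mem_Ico.1 hj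
      obtain ⟨-, l, hl⟩ := expSlope_eq_zero_iff.1 h
      have h2 : etaRoot n ^ j * m = l := by
        apply mul_right_cancel₀ Complex.two_pi_I_ne_zero
        rw [← hl, ht]
        ring
      have h3 := congrArg Complex.im h2
      rw [show ((m : ℂ)) = ((m : ℝ) : ℂ) by simp, Complex.im_mul_ofReal, Complex.intCast_im] at h3
      exact mul_ne_zero (etaRoot_pow_im_pos hj1 hjn).ne' (by exact_mod_cast hm) h3
    refine ((tendsto_sub_mul_bernoulliSym y hm).mul
      (hc.tendsto.mono_left nhdsWithin_le_nhds)).congr fun z => ?_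
    rw [bernoulliProd_eq_mul hn, mul_assoc]
  have h2 : Filter.Tendsto (fun z => (etaRoot n ^ k)⁻¹ * z)
      (nhdsWithin (t * etaRoot n ^ k) {t * etaRoot n ^ k}ᶜ) (nhdsWithin t {t}ᶜ) := by
    refine tendsto_nhdsWithin_iff.2 ⟨?_, ?_⟩
    · have h3 : Continuous fun z => (etaRoot n ^ k)⁻¹ * z := by fun_prop
      have h4 := (h3.tendsto (t * etaRoot n ^ k)).mono_left
        (nhdsWithin_le_nhds (s := {t * etaRoot n ^ k}ᶜ))
      rwa [mul_comm t, inv_mul_cancel_left₀ he, mul_comm _ t] at h4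
    · filter_upwards [self_mem_nhdsWithin] with z hz hzt
      refine hz ?_
      rw [Set.mem_singleton_iff, ← hzt]
      field_simp
  refine ((h1.comp h2).const_mul (etaRoot n ^ k)).congr fun z => ?_
  have h3 : bernoulliProd n y ((etaRoot n ^ k)⁻¹ * z) = bernoulliProd n y z := by
    rw [← bernoulliProd_etaRoot_pow_mul hn y k, mul_inv_cancel_left₀ he]
  simp only [Function.comp_apply, h3]
  field_simp

/-! ### The Taylor coefficients of the product -/

theorem coeff_taylorSeries_bernoulliSym (y : ℝ) {c : ℂ} (hc : c ≠ 0) (k : ℕ) :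
    PowerSeries.coeff k (taylorSeries fun z => bernoulliSym y (c * z)) =
      (1 + (-1) ^ k) * (((bernoulliFun k y : ℝ) : ℂ) / (k.factorial : ℂ)) * c ^ k := by
  have h1 : (1 - (y : ℂ)) = ((1 - y : ℝ) : ℂ) := by push_cast; ring
  simp only [bernoulliSym]
  rw [taylorSeries_add (analyticAt_bernoulliGen_mul_zero _ _)
    (analyticAt_bernoulliGen_mul_zero _ _), map_add, h1, coeff_taylorSeries_bernoulliGen _ hc,
    coeff_taylorSeries_bernoulliGen _ hc, bernoulliFun_eval_one_sub]
  push_cast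
  ring

/-- The sum `bernoulliSum` is a Taylor coefficient of `bernoulliProd`: only the even coefficients
of the factors are nonzero. -/
theorem coeff_taylorSeries_bernoulliProd (n : ℕ) (y : ℝ) (p : ℕ) :
    PowerSeries.coeff (2 * p) (taylorSeries (bernoulliProd n y)) =
      2 ^ n * bernoulliSum n p y := by
  have h0 : bernoulliProd n y =
      fun z => ∏ j : Fin n, bernoulliSym y (etaRoot n ^ (j : ℕ) * z) := by
    funext z
    rw [bernoulliProd, Finset.prod_range]
  rw [h0, taylorSeries_prod _ fun j _ =>
    analyticAt_bernoulliSym_mul _ _ (by simp [expSlope_zero]), PowerSeries.coeff_prod]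
  simp only [coeff_taylorSeries_bernoulliSym y (pow_ne_zero _ (etaRoot_ne_zero n))]
  rw [bernoulliSum, Finset.mul_sum]
  symm
  refine Finset.sum_of_injOn (fun m => Finsupp.equivFunOnFinite.symm fun i => 2 * m i) ?_ ?_ ?_ ?_
  · intro m _ m' _ h
    funext i
    have := DFunLike.congr_fun h i
    simpa using this
  · intro m hm
    have hm' : ((∑ j, m j : ℕ) : ℤ) = p := mem_compositionsOf.1 hm
    simp only [Finset.mem_coe, Finset.mem_finsuppAntidiag, Finset.subset_univ, and_true]
    simp only [Finsupp.equivFunOnFinite_symm_apply_apply, ← Finset.mul_sum]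
    exact congrArg _ (by exact_mod_cast hm')
  · intro l hl hl'
    -- an exponent vector which is not `2m` has an odd entry
    by_cases hodd : ∃ i, Odd (l i)
    · obtain ⟨i, hi⟩ := hodd
      exact Finset.prod_eq_zero (Finset.mem_univ i) (by simp [hi.neg_one_pow])
    · exfalso
      simp only [not_exists, Nat.not_odd_iff_even] at hodd
      refine hl' ⟨fun i => l i / 2, ?_, ?_⟩
      · have hsum : ∑ i, l i = 2 * p := by simpa using (Finset.mem_finsuppAntidiag.1 hl).1
        rw [Finset.mem_coe, mem_compositionsOf]
        have h2 : 2 * ∑ i, l i / 2 = 2 * p := by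
          rw [← hsum, Finset.mul_sum]
          exact Finset.sum_congr rfl fun i _ => Nat.two_mul_div_two_of_even (hodd i)
        exact_mod_cast Nat.eq_of_mul_eq_mul_left two_pos h2
      · ext i
        simpa using Nat.two_mul_div_two_of_even (hodd i)
  · intro m _
    rw [show (2 : ℂ) ^ n = ∏ _i : Fin n, (2 : ℂ) by simp, ← Finset.prod_mul_distrib]
    refine Finset.prod_congr rfl fun i _ => ?_
    simp only [Finsupp.equivFunOnFinite_symm_apply_apply, ← pow_mul, even_two_mul, Even.neg_pow,
      one_pow]
    rw [show 2 * (i : ℕ) * m i = (i : ℕ) * (2 * m i) by ring]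
    ring

/-! ### The terms of the series -/

theorem seriesTerm_eq (n : ℕ) (p : ℤ) (y : ℝ) (m : ℤ) :
    seriesTerm n p y m = Complex.cos (2 * m * π * y) / (m : ℂ) ^ (2 * p + 1 - (n : ℤ)) *
      ∏ j ∈ Finset.Ico 1 n,
        Complex.cosh (etaRoot n ^ j * (m * (2 * π * Complex.I)) * (y - 1 / 2)) /
          Complex.sinh (etaRoot n ^ j * (m * (2 * π * Complex.I)) / 2) := by
  rw [seriesTerm]
  congr 1
  refine Finset.prod_congr rfl fun j _ => ?_
  congr 2 <;> ring

theorem seriesTerm_zero {n : ℕ} (hn : 2 ≤ n) (p : ℤ) (y : ℝ) : seriesTerm n p y 0 = 0 := by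
  rw [seriesTerm_eq, Finset.prod_eq_zero (i := 1) (by simp; omega) (by simp), mul_zero]

/-- The residues of `t^{-2p-1} bernoulliProd n y t` at the points `2πi m`, in terms of the series. -/
theorem residue_eq_seriesTerm {n : ℕ} (hn : n ≠ 0) (p : ℤ) (y : ℝ) {m : ℤ} (hm : m ≠ 0) :
    (m * (2 * π * Complex.I) : ℂ) ^ (-(2 * p + 1)) *
        (m * (2 * π * Complex.I) * (2 * Complex.cos (2 * m * π * y)) *
          ∏ j ∈ Finset.Ico 1 n, bernoulliSym y (etaRoot n ^ j * (m * (2 * π * Complex.I)))) =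
      2 * (2 * π * Complex.I) ^ ((n : ℤ) - (2 * p + 1)) * etaRoot n ^ (n * (n - 1) / 2) *
        seriesTerm n p y m := by
  have hm' : (m : ℂ) ≠ 0 := by exact_mod_cast hm
  have hpi := Complex.two_pi_I_ne_zero
  have h1 : ∏ j ∈ Finset.Ico 1 n, bernoulliSym y (etaRoot n ^ j * (m * (2 * π * Complex.I))) =
      etaRoot n ^ (n * (n - 1) / 2) * (m * (2 * π * Complex.I)) ^ (n - 1) *
      ∏ j ∈ Finset.Ico 1 n,
        Complex.cosh (etaRoot n ^ j * (m * (2 * π * Complex.I)) * (y - 1 / 2)) /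
          Complex.sinh (etaRoot n ^ j * (m * (2 * π * Complex.I)) / 2) := by
    rw [← prod_etaRoot_pow, Finset.range_eq_Ico,
      Finset.prod_eq_prod_Ico_succ_bot (Nat.pos_of_ne_zero hn), pow_zero, one_mul]
    have hcard : (m * (2 * π * Complex.I) : ℂ) ^ (n - 1) =
        ∏ _j ∈ Finset.Ico 1 n, (m * (2 * π * Complex.I) : ℂ) := by simp
    rw [hcard, ← Finset.prod_mul_distrib, ← Finset.prod_mul_distrib]
    refine Finset.prod_congr rfl fun j _ => ?_
    rw [bernoulliSym_eq _ (mul_ne_zero (pow_ne_zero j (etaRoot_ne_zero n)) (mul_ne_zero hm' hpi))]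
  rw [h1, seriesTerm_eq]
  set Q := ∏ j ∈ Finset.Ico 1 n,
        Complex.cosh (etaRoot n ^ j * (m * (2 * π * Complex.I)) * (y - 1 / 2)) /
          Complex.sinh (etaRoot n ^ j * (m * (2 * π * Complex.I)) / 2)
  set t : ℂ := m * (2 * π * Complex.I) with ht
  have ht0 : t ≠ 0 := mul_ne_zero hm' hpi
  have h2 : t ^ (-(2 * p + 1)) * (t * t ^ (n - 1)) = t ^ ((n : ℤ) - (2 * p + 1)) := by
    rw [← pow_succ', Nat.sub_add_cancel (Nat.pos_of_ne_zero hn), ← zpow_natCast, ← zpow_add₀ ht0]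
    congr 1
    ring
  have h3 : t ^ ((n : ℤ) - (2 * p + 1)) = ((m : ℂ) ^ (2 * p + 1 - (n : ℤ)))⁻¹ *
      (2 * π * Complex.I) ^ ((n : ℤ) - (2 * p + 1)) := by
    rw [ht, mul_zpow, ← zpow_neg, neg_sub]
  rw [div_eq_mul_inv]
  linear_combination (2 * Complex.cos (2 * m * π * y) * etaRoot n ^ (n * (n - 1) / 2) * Q) *
    (h2.trans h3)

/-- The range of parameters: there is exponential decay for `0 < y < 1`, and decay of the power
of `t` for `y ∈ {0, 1}`. -/
theorem decay_cases {n : ℕ} {p : ℤ} {y : ℝ}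
    (h : (0 < y ∧ y < 1) ∨ ((y = 0 ∨ y = 1) ∧ (n : ℤ) < 2 * p)) {c : ℝ} (hc : 0 < c) :
    0 < (1 / 2 - |y - 1 / 2|) * c ∨
      ((1 / 2 - |y - 1 / 2|) * c = 0 ∧ (n : ℤ) - (2 * p + 1) ≤ -2) := by
  rcases h with ⟨h0, h1⟩ | ⟨hy, hp⟩
  · left
    have : |y - 1 / 2| < 1 / 2 := by rw [abs_lt]; constructor <;> linarith
    exact mul_pos (by linarith) hc
  · right
    refine ⟨?_, by omega⟩
    have : |y - 1 / 2| = 1 / 2 := by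
      rcases hy with rfl | rfl
      · rw [abs_of_neg] <;> norm_num
      · rw [abs_of_pos] <;> norm_num
    rw [this]
    ring

theorem half_sub_abs_nonneg {n : ℕ} {p : ℤ} {y : ℝ}
    (h : (0 < y ∧ y < 1) ∨ ((y = 0 ∨ y = 1) ∧ (n : ℤ) < 2 * p)) : 0 ≤ 1 / 2 - |y - 1 / 2| := by
  rcases decay_cases h one_pos with h | h
  · linarith
  · linarith [h.1]

theorem summable_seriesTerm {n : ℕ} (hn : 2 ≤ n) {p : ℤ} {y : ℝ}
    (h : (0 < y ∧ y < 1) ∨ ((y = 0 ∨ y = 1) ∧ (n : ℤ) < 2 * p)) :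
    Summable (seriesTerm n p y) := by
  set δ := 1 / 2 - |y - 1 / 2| with hδ
  have hδ0 : 0 ≤ δ := half_sub_abs_nonneg h
  have him : ∀ j ∈ Finset.Ico 1 n, 0 < (etaRoot n ^ j).im := fun j hj =>
    etaRoot_pow_im_pos (Finset.mem_Ico.1 hj).1 (Finset.mem_Ico.1 hj).2
  have hre : ∀ j (m : ℤ), |(etaRoot n ^ j * (m * (2 * π * Complex.I))).re| =
      2 * π * |(etaRoot n ^ j).im| * |(m : ℝ)| := by
    intro j m
    have : (etaRoot n ^ j * (m * (2 * π * Complex.I))).re =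
        -(2 * π * (etaRoot n ^ j).im * m) := by
      rw [show (m * (2 * π * Complex.I) : ℂ) = ((m * (2 * π) : ℝ) : ℂ) * Complex.I by
        push_cast; ring, Complex.mul_re]
      simp
      ring
    rw [this, abs_neg, abs_mul, abs_mul, abs_of_pos Real.two_pi_pos]
  set C : ℕ → ℝ := fun j => (1 - Real.exp (-(2 * (π * |(etaRoot n ^ j).im|)))) / 2 with hC
  have hCpos : ∀ j ∈ Finset.Ico 1 n, 0 < C j := by
    intro j hj
    have h1 : 0 < |(etaRoot n ^ j).im| := abs_pos.2 (him j hj).ne'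
    have : Real.exp (-(2 * (π * |(etaRoot n ^ j).im|))) < 1 := by
      rw [Real.exp_lt_one_iff]
      have := Real.pi_pos
      nlinarith [mul_pos Real.pi_pos h1]
    simp only [hC]
    linarith
  set κ := 2 * π * |(etaRoot n ^ 1).im| with hκ
  have h1mem : 1 ∈ Finset.Ico 1 n := by simp; omega
  have hκpos : 0 < κ := by
    have := abs_pos.2 (him 1 h1mem).ne'
    have := Real.pi_pos
    positivity
  obtain ⟨B, hB⟩ := exists_zpow_mul_exp_le (decay_cases h hκpos)
  set D := ∏ j ∈ Finset.Ico 1 n, (C j)⁻¹ with hD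
  have hD0 : 0 ≤ D := Finset.prod_nonneg fun j hj => (inv_pos.2 (hCpos j hj)).le
  have hbound : ∀ m : ℤ, ‖seriesTerm n p y m‖ ≤ D * B * (1 / |(m : ℝ)| ^ 2) := by
    intro m
    rcases eq_or_ne m 0 with rfl | hm
    · rw [seriesTerm_zero hn]; simp
    have hm1 : (1 : ℝ) ≤ |(m : ℝ)| := by exact_mod_cast Int.one_le_abs hm
    have hfac : ∀ j ∈ Finset.Ico 1 n,
        ‖Complex.cosh (etaRoot n ^ j * (m * (2 * π * Complex.I)) * (y - 1 / 2)) /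
          Complex.sinh (etaRoot n ^ j * (m * (2 * π * Complex.I)) / 2)‖ ≤
        (C j)⁻¹ * Real.exp (-(δ * (2 * π * |(etaRoot n ^ j).im| * |(m : ℝ)|))) := by
      intro j hj
      have h2 := norm_cosh_div_sinh_le (y := y) (c := C j)
        (t := etaRoot n ^ j * (m * (2 * π * Complex.I))) (hCpos j hj) ?_
      · rwa [hre] at h2
      · apply exp_abs_re_le_norm_sinh
        have h3 : |((etaRoot n ^ j * (m * (2 * π * Complex.I))) / 2).re| =
            π * |(etaRoot n ^ j).im| * |(m : ℝ)| := by
          rw [show (((etaRoot n ^ j * (m * (2 * π * Complex.I))) / 2).re : ℝ) =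
            (etaRoot n ^ j * (m * (2 * π * Complex.I))).re / 2 by simp, abs_div, hre, abs_two]
          ring
        rw [h3]
        exact le_mul_of_one_le_right (mul_nonneg Real.pi_pos.le (abs_nonneg _)) hm1
    have hcos : ‖Complex.cos (2 * m * π * y)‖ ≤ 1 := by
      rw [show (2 * m * π * y : ℂ) = ((2 * m * π * y : ℝ) : ℂ) by push_cast; ring,
        ← Complex.ofReal_cos, Complex.norm_real]
      exact Real.abs_cos_le_one _
    have hexp : ∏ j ∈ Finset.Ico 1 n,
        Real.exp (-(δ * (2 * π * |(etaRoot n ^ j).im| * |(m : ℝ)|))) ≤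
        Real.exp (-(δ * κ * |(m : ℝ)|)) := by
      rw [← Finset.mul_prod_erase _ _ h1mem]
      have h4 : ∏ j ∈ (Finset.Ico 1 n).erase 1,
          Real.exp (-(δ * (2 * π * |(etaRoot n ^ j).im| * |(m : ℝ)|))) ≤ 1 := by
        refine Finset.prod_le_one (fun j _ => (Real.exp_pos _).le) fun j _ => ?_
        rw [Real.exp_le_one_iff, neg_nonpos]
        have := Real.pi_pos
        positivity
      refine (mul_le_of_le_one_right (Real.exp_pos _).le h4).trans_eq ?_
      rw [hκ]
      congr 1
      ring
    rw [seriesTerm_eq, norm_mul, norm_div, norm_zpow, norm_prod]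
    calc _ ≤ 1 / ‖(m : ℂ)‖ ^ (2 * p + 1 - (n : ℤ)) * ∏ j ∈ Finset.Ico 1 n,
          ((C j)⁻¹ * Real.exp (-(δ * (2 * π * |(etaRoot n ^ j).im| * |(m : ℝ)|)))) := by
          refine mul_le_mul ?_ (Finset.prod_le_prod (fun _ _ => norm_nonneg _) hfac)
            (Finset.prod_nonneg fun _ _ => norm_nonneg _) (by positivity)
          gcongr
      _ = D * (|(m : ℝ)| ^ ((n : ℤ) - (2 * p + 1)) * ∏ j ∈ Finset.Ico 1 n,
          Real.exp (-(δ * (2 * π * |(etaRoot n ^ j).im| * |(m : ℝ)|)))) := by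
          rw [Finset.prod_mul_distrib, Complex.norm_intCast, one_div, ← zpow_neg, neg_sub]
          ring
      _ ≤ D * (|(m : ℝ)| ^ ((n : ℤ) - (2 * p + 1)) * Real.exp (-(δ * κ * |(m : ℝ)|))) := by
          gcongr
      _ ≤ D * (B * |(m : ℝ)| ^ (-2 : ℤ)) := mul_le_mul_of_nonneg_left (hB _ hm1) hD0
      _ = _ := by
          rw [zpow_neg, one_div, mul_assoc]
          rfl
  refine Summable.of_norm_bounded ?_ hbound
  refine Summable.mul_left _ ?_
  simpa using (Real.summable_one_div_int_pow (p := 2)).2 one_lt_two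

/-! ### Growth on circles -/

/-- On the circles of radius `2π (N + 1/2)`, the product decays exponentially for `0 < y < 1`. -/
theorem norm_bernoulliProd_le {n : ℕ} (hn : 2 ≤ n) {y : ℝ} (hy : 0 ≤ 1 / 2 - |y - 1 / 2|) {N : ℕ}
    {t : ℂ} (ht : ‖t‖ = 2 * π * (N + 1 / 2)) :
    ‖bernoulliProd n y t‖ ≤ (8 * ‖t‖) ^ n *
      Real.exp (-((1 / 2 - |y - 1 / 2|) * (|(etaRoot n).im| / 2) * ‖t‖)) := by
  set δ := 1 / 2 - |y - 1 / 2| with hδ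
  have ht0 : t ≠ 0 := by
    rw [← norm_pos_iff, ht]
    have := Real.pi_pos
    positivity
  have hfac : ∀ j ∈ Finset.range n, ‖bernoulliSym y (etaRoot n ^ j * t)‖ ≤
      8 * ‖t‖ * Real.exp (-(δ * |(etaRoot n ^ j * t).re|)) := by
    intro j _
    have hnorm : ‖etaRoot n ^ j * t‖ = ‖t‖ := by rw [norm_mul, norm_etaRoot_pow, one_mul]
    have h1 := norm_cosh_div_sinh_le (y := y) (c := 1 / 8) (t := etaRoot n ^ j * t) (by norm_num)
      (exp_abs_re_le_norm_sinh_of_norm_eq (N := N) (by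
        rw [norm_div, hnorm, ht, Complex.norm_ofNat]; ring))
    rw [bernoulliSym_eq _ (mul_ne_zero (pow_ne_zero j (etaRoot_ne_zero n)) ht0), norm_mul, hnorm]
    calc _ ≤ ‖t‖ * ((1 / 8 : ℝ)⁻¹ * Real.exp (-(δ * |(etaRoot n ^ j * t).re|))) := by gcongr
      _ = _ := by norm_num; ring
  rw [bernoulliProd, norm_prod]
  refine (Finset.prod_le_prod (fun _ _ => norm_nonneg _) hfac).trans ?_
  rw [Finset.prod_mul_distrib, Finset.prod_const, Finset.card_range, ← Real.exp_sum]
  gcongr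
  rw [Finset.sum_neg_distrib, neg_le_neg_iff, ← Finset.mul_sum, mul_assoc]
  gcongr
  -- already the factors with `j = 0` and `j = 1` give the claimed decay
  have h2 := abs_im_mul_norm_le (e := etaRoot n) (t := t) (by simpa using norm_etaRoot_pow n 1)
  refine h2.trans ?_
  have h3 : ∑ j ∈ Finset.range 2, |(etaRoot n ^ j * t).re| ≤
      ∑ j ∈ Finset.range n, |(etaRoot n ^ j * t).re| :=
    Finset.sum_le_sum_of_subset_of_nonneg (Finset.range_mono hn) fun _ _ _ => abs_nonneg _
  simpa [Finset.sum_range_succ] using h3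

/-! ### The sum of the residues -/

/-- A circle around `0` sees only the coefficient of `t⁻¹`: polynomials of degree less than `k`,
divided by `z ^ q` with `q > k`, integrate to zero. -/
theorem circleIntegral_zpow_mul_polynomial (g : ℕ → ℂ) (k : ℕ) {q : ℤ} (hq : k ≤ q - 1) {R : ℝ}
    (hR : 0 < R) :
    (∮ z in C(0, R), z ^ (-q) * ∑ i ∈ Finset.range k, g i * z ^ i) = 0 := by
  have hne : ∀ z ∈ Metric.sphere (0 : ℂ) R, z ≠ 0 := by
    rintro z hz rfl
    simp [hR.ne] at hz
  have h1 : (∮ z in C(0, R), z ^ (-q) * ∑ i ∈ Finset.range k, g i * z ^ i) =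
      ∮ z in C(0, R), ∑ i ∈ Finset.range k, g i * (z - 0) ^ ((i : ℤ) - q) := by
    refine circleIntegral.integral_congr hR.le fun z hz => ?_
    rw [Finset.mul_sum]
    refine Finset.sum_congr rfl fun i _ => ?_
    rw [sub_zero, sub_eq_neg_add (i : ℤ) q, zpow_add₀ (hne z hz), zpow_natCast]
    ring
  rw [h1, circleIntegral.integral_fun_sum]
  · refine Finset.sum_eq_zero fun i hi => ?_
    have hik := Finset.mem_range.1 hi
    rw [circleIntegral.integral_const_mul, circleIntegral.integral_sub_zpow_of_ne (by omega),
      mul_zero]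
  · intro i _
    refine ContinuousOn.circleIntegrable hR.le fun z hz => ContinuousAt.continuousWithinAt ?_
    have := hne z hz
    refine ContinuousAt.mul (by fun_prop) (ContinuousAt.zpow₀ (by fun_prop) _ (Or.inl ?_))
    simpa using this

/-- Subtracting the Taylor polynomial of degree less than `2p` leaves a simple pole at `0`. -/
theorem tendsto_mul_zpow_mul_sub_taylor {G : ℂ → ℂ} (hG : AnalyticAt ℂ G 0) (p : ℤ) :
    Filter.Tendsto (fun z => (z - 0) * (z ^ (-(2 * p + 1)) *
        (G z - ∑ i ∈ Finset.range (2 * p).toNat,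
          PowerSeries.coeff i (taylorSeries G) * z ^ i)))
      (nhdsWithin 0 {0}ᶜ)
      (nhds (if 0 ≤ p then PowerSeries.coeff (2 * p.toNat) (taylorSeries G) else 0)) := by
  split_ifs with hp
  · lift p to ℕ using hp
    have hk : (2 * (p : ℤ)).toNat = 2 * p := by omega
    rw [hk, Int.toNat_natCast]
    set k := 2 * p with hk'
    set g := fun i => PowerSeries.coeff i (taylorSeries G) with hg
    have hO := isBigO_sub_taylorSeries hG (k + 1)
    have h1 : Filter.Tendsto (fun z => (z ^ k)⁻¹ * (G z - ∑ i ∈ Finset.range (k + 1), g i * z ^ i))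
        (nhdsWithin 0 {0}ᶜ) (nhds 0) := by
      have h2 := (Asymptotics.isBigO_refl (fun z : ℂ => (z ^ k)⁻¹) (nhdsWithin 0 {0}ᶜ)).mul
        (hO.mono (nhdsWithin_le_nhds (s := {0}ᶜ)))
      refine h2.trans_tendsto ?_
      have h3 : Filter.Tendsto (fun z : ℂ => z) (nhdsWithin 0 {0}ᶜ) (nhds 0) :=
        Filter.tendsto_id.mono_left nhdsWithin_le_nhds
      refine h3.congr' ?_
      filter_upwards [self_mem_nhdsWithin] with z hz
      have hz' : z ≠ 0 := hz
      rw [pow_succ]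
      field_simp
    have h4 := h1.add_const (g k)
    rw [zero_add] at h4
    refine h4.congr' ?_
    filter_upwards [self_mem_nhdsWithin] with z hz
    have hz' : z ≠ 0 := hz
    have h5 : z ^ (-(2 * (p : ℤ) + 1)) = (z ^ (k + 1))⁻¹ := by
      rw [zpow_neg, ← zpow_natCast, hk']
      push_cast
      rfl
    rw [h5, Finset.sum_range_succ, pow_succ, sub_zero]
    field_simp
    ring
  · obtain ⟨k, hk⟩ : ∃ k : ℕ, -(2 * p) = k + 1 := ⟨(-(2 * p) - 1).toNat, by omega⟩
    have h0 : (2 * p).toNat = 0 := by omega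
    have h1 : Filter.Tendsto (fun z => z ^ (k + 1) * G z) (nhdsWithin 0 {0}ᶜ) (nhds 0) := by
      have h2 : ContinuousAt (fun z => z ^ (k + 1) * G z) 0 :=
        (ContinuousAt.pow continuousAt_id _).mul hG.continuousAt
      simpa using h2.tendsto.mono_left (nhdsWithin_le_nhds (s := {0}ᶜ))
    refine h1.congr' ?_
    filter_upwards [self_mem_nhdsWithin] with z hz
    have hz' : z ≠ 0 := hz
    rw [h0, Finset.range_zero, Finset.sum_empty, sub_zero, sub_zero, ← mul_assoc,
      ← zpow_one_add₀ hz', show (1 : ℤ) + -(2 * p + 1) = ((k + 1 : ℕ) : ℤ) by push_cast; omega,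
      zpow_natCast]

/-- The residue at the origin, for arbitrary `p ∈ ℤ`. -/
theorem residue_zero_eq (n : ℕ) (p : ℤ) (y : ℝ) :
    (if 0 ≤ p then PowerSeries.coeff (2 * p.toNat) (taylorSeries (bernoulliProd n y)) else 0) =
      2 ^ n * bernoulliSum n p y := by
  split_ifs with hp
  · rw [coeff_taylorSeries_bernoulliProd, Int.toNat_of_nonneg hp]
  · simp [bernoulliSum, compositionsOf, hp]

/-- The residue theorem for `t^{-2p-1} bernoulliProd n y t` on the circle of radius
`2π (N + 1/2)`. -/
theorem circleIntegral_bernoulliProd {n : ℕ} (hn : 2 ≤ n) (p : ℤ) (y : ℝ) (N : ℕ) :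
    (∮ z in C(0, 2 * π * (N + 1 / 2)), z ^ (-(2 * p + 1)) * bernoulliProd n y z) =
      2 * π * Complex.I * (2 ^ n * bernoulliSum n p y +
        2 * (2 * π * Complex.I) ^ ((n : ℤ) - (2 * p + 1)) * etaRoot n ^ (n * (n - 1) / 2) *
          (zFactor n (2 * p + 1) * ∑ m ∈ Finset.Icc (-(N : ℤ)) N, seriesTerm n p y m)) := by
  have hn0 : n ≠ 0 := by omega
  have hpi := Real.pi_pos
  set R : ℝ := 2 * π * (N + 1 / 2) with hR
  have hRpos : 0 < R := by positivity
  set q : ℤ := 2 * p + 1 with hq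
  set G := bernoulliProd n y with hG
  set k := (2 * p).toNat with hk
  set P : ℂ → ℂ := fun z => ∑ i ∈ Finset.range k, PowerSeries.coeff i (taylorSeries G) * z ^ i
    with hP
  set F : ℂ → ℂ := fun z => z ^ (-q) * (G z - P z) with hF
  set w : ℤ × ℕ → ℂ := fun i => i.1 * (2 * π * Complex.I) * etaRoot n ^ i.2 with hw
  set T : Finset (ℤ × ℕ) := (Finset.Icc (-(N : ℤ)) N).erase 0 ×ˢ Finset.range n with hT
  have hTmem : ∀ i ∈ T, i.1 ≠ 0 ∧ i.2 < n ∧ |i.1| ≤ N := by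
    intro i hi
    rw [hT, Finset.mem_product, Finset.mem_erase, Finset.mem_Icc, Finset.mem_range] at hi
    exact ⟨hi.1.1, hi.2, abs_le.2 hi.1.2⟩
  have hnorm : ∀ i, ‖w i‖ = 2 * π * |(i.1 : ℝ)| := by
    intro i
    rw [hw]
    simp only [norm_mul, norm_etaRoot_pow, Complex.norm_intCast, Complex.norm_I, mul_one,
      Complex.norm_ofNat, Complex.norm_real, Real.norm_eq_abs, abs_of_pos hpi]
    ring
  have hw0 : ∀ i : ℤ × ℕ, i.1 ≠ 0 → w i ≠ 0 := by
    intro i hi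
    rw [← norm_pos_iff, hnorm]
    have : 0 < |(i.1 : ℝ)| := abs_pos.2 (by exact_mod_cast hi)
    positivity
  have h0T : (0, 0) ∉ T := fun h => (hTmem _ h).1 rfl
  have hw00 : w (0, 0) = 0 := by simp [hw]
  have hPan : ∀ z, AnalyticAt ℂ P z := fun z => by
    refine Finset.analyticAt_fun_sum _ fun i _ => ?_
    fun_prop
  -- the index `(0, 0)` stands for the pole at the origin
  set c : ℤ × ℕ → ℂ := fun i => if i.1 = 0 then 2 ^ n * bernoulliSum n p y else
    2 * (2 * π * Complex.I) ^ ((n : ℤ) - q) * etaRoot n ^ (n * (n - 1) / 2) *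
      (etaRoot n ^ ((i.2 : ℤ) * (1 - q)) * seriesTerm n p y i.1) with hc
  have hres := circleIntegral_eq_sum_simple_poles (F := F) (x := 0) hRpos.le
    (insert (0, 0) T) w c ?_ ?_ ?_ ?_ ?_
  · have hFG : (∮ z in C(0, R), F z) = ∮ z in C(0, R), z ^ (-q) * G z := by
      have hsph : ∀ z ∈ Metric.sphere (0 : ℂ) R, z ≠ 0 := by
        rintro z hz rfl
        simp [hRpos.ne] at hz
      have hzint : ∀ z ∈ Metric.sphere (0 : ℂ) R, ContinuousAt (fun z : ℂ => z ^ (-q)) z :=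
        fun z hz => continuousAt_zpow₀ z _ (Or.inl (hsph z hz))
      have hGc : ∀ z ∈ Metric.sphere (0 : ℂ) R, ContinuousAt G z := by
        intro z hz
        refine (analyticAt_bernoulliProd y fun m _ j _ h => ?_).continuousAt
        have h1 : ‖w (m, j)‖ = 2 * π * |(m : ℝ)| := hnorm (m, j)
        rw [hw] at h1
        simp only at h1
        rw [← h, mem_sphere_zero_iff_norm.1 hz, hR] at h1
        have h2 := mul_left_cancel₀ (by positivity) h1
        have h3 : ((2 * N + 1 : ℤ) : ℝ) = ((2 * |m| : ℤ) : ℝ) := by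
          push_cast
          linarith
        have h4 : (2 * N + 1 : ℤ) = 2 * |m| := by exact_mod_cast h3
        omega
      have h1 := circleIntegral.integral_sub (c := 0) (R := R)
        (f := fun z => z ^ (-q) * G z) (g := fun z => z ^ (-q) * P z)
        (ContinuousOn.circleIntegrable hRpos.le fun z hz =>
          ((hzint z hz).mul (hGc z hz)).continuousWithinAt)
        (ContinuousOn.circleIntegrable hRpos.le fun z hz =>
          ((hzint z hz).mul (hPan z).continuousAt).continuousWithinAt)
      have h2 : (∮ z in C(0, R), z ^ (-q) * P z) = 0 := by
        rcases Nat.eq_zero_or_pos k with h0 | h0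
        · simp [hP, h0, circleIntegral]
        · exact circleIntegral_zpow_mul_polynomial _ k (by omega) hRpos
      rw [h2, sub_zero] at h1
      rw [← h1]
      simp only [hF, mul_sub]
    rw [← hFG, hres, Finset.sum_insert h0T]
    congr 1
    have hc0 : c (0, 0) = 2 ^ n * bernoulliSum n p y := by simp [hc]
    rw [hc0]
    congr 1
    have hcT : ∀ i ∈ T, c i = 2 * (2 * π * Complex.I) ^ ((n : ℤ) - q) *
        etaRoot n ^ (n * (n - 1) / 2) *
        (etaRoot n ^ ((i.2 : ℤ) * (1 - q)) * seriesTerm n p y i.1) := by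
      intro i hi
      simp only [hc, if_neg (hTmem i hi).1]
    rw [Finset.sum_congr rfl hcT, ← Finset.mul_sum, hT, Finset.sum_product]
    congr 1
    rw [zFactor, Finset.mul_sum, ← Finset.sum_erase (Finset.Icc (-(N : ℤ)) N) (a := 0)
      (by rw [seriesTerm_zero hn, mul_zero])]
    exact Finset.sum_congr rfl fun m _ => by rw [Finset.sum_mul]
  · intro i hi j hj h
    simp only [Finset.coe_insert, Set.mem_insert_iff, Finset.mem_coe] at hi hj
    rcases hi with rfl | hi <;> rcases hj with rfl | hj
    · rfl
    · exact absurd (h.symm.trans hw00) (hw0 j (hTmem j hj).1)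
    · exact absurd (h.trans hw00) (hw0 i (hTmem i hi).1)
    · exact mul_etaRoot_pow_injOn n ⟨(hTmem i hi).1, (hTmem i hi).2.1⟩
        ⟨(hTmem j hj).1, (hTmem j hj).2.1⟩ h
  · intro i hi
    rw [mem_ball_zero_iff, hnorm, hR]
    have h1 : |(i.1 : ℝ)| ≤ N := by
      rcases Finset.mem_insert.1 hi with rfl | hi
      · simp
      · exact_mod_cast (hTmem i hi).2.2
    gcongr
    linarith
  · intro z hz hzw
    have hz0 : z ≠ 0 := by
      have := hzw (0, 0) (Finset.mem_insert_self _ _)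
      rwa [hw00] at this
    refine (AnalyticAt.zpow (by fun_prop) hz0).mul (AnalyticAt.sub ?_ (hPan z))
    refine analyticAt_bernoulliProd y fun m hm j hj h => ?_
    refine hzw (m, j) (Finset.mem_insert_of_mem ?_) h
    have h1 : ‖w (m, j)‖ = 2 * π * |(m : ℝ)| := hnorm (m, j)
    rw [hw] at h1
    simp only at h1
    rw [← h] at h1
    rw [mem_closedBall_zero_iff, h1, hR] at hz
    have h2 := le_of_mul_le_mul_left hz (by positivity)
    have h3 : ((2 * |m| : ℤ) : ℝ) ≤ ((2 * N + 1 : ℤ) : ℝ) := by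
      push_cast
      linarith
    have h4 : (2 * |m| : ℤ) ≤ 2 * N + 1 := by exact_mod_cast h3
    rw [hT, Finset.mem_product, Finset.mem_erase, Finset.mem_Icc, Finset.mem_range]
    have h5 : |m| ≤ N := by omega
    exact ⟨⟨hm, abs_le.1 h5⟩, hj⟩
  · intro i _
    refine MeromorphicAt.mul (MeromorphicAt.zpow (MeromorphicAt.id _) _)
      ((meromorphicAt_bernoulliProd n y _).sub (hPan _).meromorphicAt)
  · intro i hi
    rcases Finset.mem_insert.1 hi with rfl | hi
    · have h1 := tendsto_mul_zpow_mul_sub_taylor (analyticAt_bernoulliProd_zero n y) p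
      rw [residue_zero_eq] at h1
      have hc0 : c (0, 0) = 2 ^ n * bernoulliSum n p y := by simp [hc]
      rw [hw00, hc0]
      exact h1
    · obtain ⟨hi0, -, -⟩ := hTmem i hi
      have hwi := hw0 i hi0
      have h1 := tendsto_sub_mul_bernoulliProd hn0 y hi0 i.2
      have hz : ContinuousAt (fun z : ℂ => z ^ (-q)) (w i) :=
        continuousAt_zpow₀ _ _ (Or.inl hwi)
      have h2 : Filter.Tendsto (fun z => (z - w i) * P z) (nhdsWithin (w i) {w i}ᶜ) (nhds 0) := by
        have h3 : ContinuousAt (fun z => (z - w i) * P z) (w i) :=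
          ContinuousAt.mul (by fun_prop) (hPan _).continuousAt
        simpa using h3.tendsto.mono_left (nhdsWithin_le_nhds (s := {w i}ᶜ))
      have h4 := (hz.tendsto.mono_left (nhdsWithin_le_nhds (s := {w i}ᶜ))).mul (h1.sub h2)
      have h5 : c i = w i ^ (-q) * (etaRoot n ^ i.2 * (i.1 * (2 * π * Complex.I) *
          (2 * Complex.cos (2 * i.1 * π * y)) * ∏ j ∈ Finset.Ico 1 n,
            bernoulliSym y (etaRoot n ^ j * (i.1 * (2 * π * Complex.I)))) - 0) := by
        have h6 := residue_eq_seriesTerm hn0 p y hi0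
        simp only [hc, if_neg hi0]
        rw [sub_zero, hw]
        simp only
        rw [mul_left_comm _ (etaRoot n ^ ((i.2 : ℤ) * (1 - q))), ← h6,
          mul_zpow _ (etaRoot n ^ i.2),
          show (i.2 : ℤ) * (1 - q) = i.2 * (-q) + i.2 by ring, zpow_add₀ (etaRoot_ne_zero n),
          zpow_mul, zpow_natCast]
        ring
      rw [h5]
      refine h4.congr fun z => ?_
      rw [hF]
      simp only [hw]
      ring

/-- The value of the bilateral series in terms of Bernoulli polynomials. -/
theorem zFactor_mul_tsum_seriesTerm {n : ℕ} (hn : 2 ≤ n) {p : ℤ} {y : ℝ}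
    (h : (0 < y ∧ y < 1) ∨ ((y = 0 ∨ y = 1) ∧ (n : ℤ) < 2 * p)) :
    zFactor n (2 * p + 1) * ∑' m, seriesTerm n p y m =
      -(2 ^ (n - 1) * (2 * π * Complex.I) ^ (2 * p + 1 - (n : ℤ)) /
          etaRoot n ^ (n * (n - 1) / 2)) * bernoulliSum n p y := by
  have hpi := Real.pi_pos
  set q : ℤ := 2 * p + 1 with hq
  set δ := 1 / 2 - |y - 1 / 2| with hδ
  have him : 0 < |(etaRoot n).im| / 2 := by
    have := etaRoot_pow_im_pos (n := n) le_rfl (by omega)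
    rw [pow_one] at this
    have := abs_pos.2 this.ne'
    positivity
  obtain ⟨B, hB⟩ := exists_zpow_mul_exp_le (decay_cases h him)
  set R : ℕ → ℝ := fun N => 2 * π * (N + 1 / 2) with hR
  have hR1 : ∀ N, 1 ≤ R N := by
    intro N
    have h1 : (1 : ℝ) ≤ π := by linarith [Real.pi_gt_three]
    have h2 : (0 : ℝ) ≤ N := Nat.cast_nonneg N
    simp only [hR]
    nlinarith
  have hRtop : Filter.Tendsto R Filter.atTop Filter.atTop :=
    Filter.Tendsto.const_mul_atTop (by positivity)
      (Filter.tendsto_atTop_add_const_right _ _ tendsto_natCast_atTop_atTop)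
  have hint : Filter.Tendsto
      (fun N : ℕ => ∮ z in C(0, R N), z ^ (-q) * bernoulliProd n y z) Filter.atTop (nhds 0) := by
    have hb : ∀ N : ℕ, ‖∮ z in C(0, R N), z ^ (-q) * bernoulliProd n y z‖ ≤
        (2 * π * 8 ^ n * B) * (R N)⁻¹ := by
      intro N
      have hpos : 0 < R N := by linarith [hR1 N]
      have h1 := circleIntegral.norm_integral_le_of_norm_le_const (c := 0) (R := R N)
        (f := fun z => z ^ (-q) * bernoulliProd n y z) (C := 8 ^ n * (B * R N ^ (-2 : ℤ)))
        hpos.le ?_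
      · refine h1.trans_eq ?_
        rw [zpow_neg, show (R N) ^ (2 : ℤ) = R N * R N by rw [zpow_ofNat, sq]]
        field_simp
      · intro z hz
        have hz' : ‖z‖ = R N := mem_sphere_zero_iff_norm.1 hz
        have h2 := norm_bernoulliProd_le hn (half_sub_abs_nonneg h) (N := N) (t := z) hz'
        rw [hz'] at h2
        rw [norm_mul, norm_zpow, hz']
        calc _ ≤ R N ^ (-q) * ((8 * R N) ^ n *
              Real.exp (-(δ * (|(etaRoot n).im| / 2) * R N))) := by gcongr
          _ = 8 ^ n * (R N ^ ((n : ℤ) - q) *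
              Real.exp (-(δ * (|(etaRoot n).im| / 2) * R N))) := by
              rw [sub_eq_neg_add (n : ℤ) q, zpow_add₀ hpos.ne', zpow_natCast, mul_pow]
              ring
          _ ≤ _ := mul_le_mul_of_nonneg_left (hB _ (hR1 N)) (by positivity)
    refine squeeze_zero_norm hb ?_
    simpa using (tendsto_inv_atTop_zero.comp hRtop).const_mul (2 * π * 8 ^ n * B)
  have hsum : Filter.Tendsto (fun N : ℕ => ∑ m ∈ Finset.Icc (-(N : ℤ)) N, seriesTerm n p y m)
      Filter.atTop (nhds (∑' m, seriesTerm n p y m)) := by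
    have h2 : Filter.Tendsto (fun N : ℕ => Finset.Icc (-(N : ℤ)) N) Filter.atTop Filter.atTop := by
      refine Filter.tendsto_atTop_finset_of_monotone (fun a b hab => ?_) fun m => ?_
      · exact Finset.Icc_subset_Icc (by simpa using hab) (by exact_mod_cast hab)
      · exact ⟨m.natAbs, by rw [Finset.mem_Icc]; omega⟩
    exact (summable_seriesTerm hn h).hasSum.comp h2
  have hlim := tendsto_nhds_unique hint (Filter.Tendsto.congr
    (fun N => (circleIntegral_bernoulliProd hn p y N).symm)
    (((hsum.const_mul _).const_mul _).const_add _ |>.const_mul _))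
  have hpI := Complex.two_pi_I_ne_zero
  have h0 := (mul_eq_zero.1 hlim.symm).resolve_left hpI
  have he : etaRoot n ^ (n * (n - 1) / 2) ≠ 0 := pow_ne_zero _ (etaRoot_ne_zero n)
  set e := etaRoot n ^ (n * (n - 1) / 2)
  have h3 : (2 * π * Complex.I) ^ ((n : ℤ) - q) * (2 * π * Complex.I) ^ (q - (n : ℤ)) = 1 := by
    rw [← zpow_add₀ hpI]
    simp
  have h4 : (2 : ℂ) ^ n = 2 * 2 ^ (n - 1) := by
    rw [← pow_succ', Nat.sub_add_cancel (by omega)]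
  rw [h4] at h0
  rw [← neg_div, div_mul_eq_mul_div, eq_div_iff he]
  linear_combination ((2 * π * Complex.I) ^ (q - (n : ℤ)) / 2) * h0 -
    (e * (zFactor n q * ∑' m, seriesTerm n p y m)) * h3

/-! ### The Gamma integral with a complex scaling parameter -/

theorem norm_cpow_mul_exp {a w : ℂ} {t : ℝ} (ht : 0 < t) :
    ‖(t : ℂ) ^ (a - 1) * Complex.exp (-(w * t))‖ =
      t ^ (a.re - 1) * Real.exp (-(w.re * t)) := by
  rw [norm_mul, Complex.norm_cpow_eq_rpow_re_of_pos ht, Complex.norm_exp]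
  simp

theorem integrableOn_rpow_mul_exp {a r : ℝ} (ha : 0 < a) (hr : 0 < r) :
    MeasureTheory.IntegrableOn (fun t : ℝ => t ^ (a - 1) * Real.exp (-(r * t))) (Set.Ioi 0) := by
  have h := integrableOn_rpow_mul_exp_neg_mul_rpow (s := a - 1) (p := 1) (b := r) (by linarith)
    one_pos hr
  simpa using h

theorem aestronglyMeasurable_cpow_mul_exp (a w : ℂ) :
    MeasureTheory.AEStronglyMeasurable (fun t : ℝ => (t : ℂ) ^ (a - 1) * Complex.exp (-(w * t)))
      (MeasureTheory.volume.restrict (Set.Ioi 0)) := by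
  refine ContinuousOn.aestronglyMeasurable (fun t ht => ContinuousAt.continuousWithinAt ?_)
    measurableSet_Ioi
  refine ContinuousAt.mul ?_ (by fun_prop)
  exact ContinuousAt.cpow (by fun_prop) (by fun_prop) (Or.inl (by simpa using ht))

theorem integrableOn_cpow_mul_exp {a w : ℂ} (ha : 0 < a.re) (hw : 0 < w.re) :
    MeasureTheory.IntegrableOn (fun t : ℝ => (t : ℂ) ^ (a - 1) * Complex.exp (-(w * t)))
      (Set.Ioi 0) := by
  refine (integrableOn_rpow_mul_exp ha hw).mono' (aestronglyMeasurable_cpow_mul_exp a w) ?_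
  filter_upwards [MeasureTheory.ae_restrict_mem measurableSet_Ioi] with t ht
  exact (norm_cpow_mul_exp ht).le

theorem differentiableAt_integral_cpow_mul_exp {a w₀ : ℂ} (ha : 0 < a.re) (hw : 0 < w₀.re) :
    DifferentiableAt ℂ
      (fun w => ∫ t : ℝ in Set.Ioi 0, (t : ℂ) ^ (a - 1) * Complex.exp (-(w * t))) w₀ := by
  have hball : ∀ w ∈ Metric.ball w₀ (w₀.re / 2), w₀.re / 2 ≤ w.re := by
    intro w hw'
    have h1 := (Complex.abs_re_le_norm (w - w₀)).trans_lt (mem_ball_iff_norm.1 hw')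
    rw [Complex.sub_re, abs_lt] at h1
    linarith [h1.1]
  have hF'eq : ∀ (w : ℂ) (t : ℝ), 0 < t →
      (t : ℂ) ^ (a - 1) * (Complex.exp (-(w * t)) * -t) =
        -((t : ℂ) ^ (a + 1 - 1) * Complex.exp (-(w * t))) := by
    intro w t ht
    have : (t : ℂ) ≠ 0 := by exact_mod_cast ht.ne'
    rw [show a + 1 - 1 = (a - 1) + 1 by ring, Complex.cpow_add _ _ this, Complex.cpow_one]
    ring
  have ha1 : 0 < (a + 1).re := by simp; linarith
  refine (hasDerivAt_integral_of_dominated_loc_of_deriv_le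
    (F' := fun w t => (t : ℂ) ^ (a - 1) * (Complex.exp (-(w * t)) * -t))
    (bound := fun t => t ^ ((a + 1).re - 1) * Real.exp (-(w₀.re / 2 * t)))
    (Metric.ball_mem_nhds w₀ (half_pos hw)) (Filter.Eventually.of_forall fun w =>
      aestronglyMeasurable_cpow_mul_exp a w) (integrableOn_cpow_mul_exp ha hw) ?_ ?_
      (integrableOn_rpow_mul_exp ha1 (half_pos hw)) ?_).2.differentiableAt
  · refine (aestronglyMeasurable_cpow_mul_exp (a + 1) w₀).neg.congr ?_
    filter_upwards [MeasureTheory.ae_restrict_mem measurableSet_Ioi] with t ht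
    rw [Pi.neg_apply, hF'eq w₀ t ht]
  · filter_upwards [MeasureTheory.ae_restrict_mem measurableSet_Ioi] with t ht w hw'
    have ht' : 0 < t := ht
    rw [hF'eq w t ht, norm_neg, norm_cpow_mul_exp ht]
    have := hball w hw'
    gcongr
  · filter_upwards with t w _
    have h1 : HasDerivAt (fun w : ℂ => -(w * t)) (-t) w :=
      (((hasDerivAt_id w).mul_const (t : ℂ)).neg).congr_deriv (by simp)
    exact (h1.cexp).const_mul _

/-- The integral `∫₀^∞ t^{a-1} e^{-wt} dt = w^{-a} Γ(a)` for complex `w` in the right half-plane. -/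
theorem integral_cpow_mul_exp_neg_mul_complex {a w : ℂ} (ha : 0 < a.re) (hw : 0 < w.re) :
    ∫ t : ℝ in Set.Ioi 0, (t : ℂ) ^ (a - 1) * Complex.exp (-(w * t)) =
      w ^ (-a) * Complex.Gamma a := by
  set U : Set ℂ := {w | 0 < w.re} with hU
  have hUo : IsOpen U := isOpen_lt continuous_const Complex.continuous_re
  have hUc : IsPreconnected U := (convex_halfSpace_re_gt 0).isPreconnected
  have h1 : AnalyticOnNhd ℂ
      (fun w => ∫ t : ℝ in Set.Ioi 0, (t : ℂ) ^ (a - 1) * Complex.exp (-(w * t))) U :=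
    DifferentiableOn.analyticOnNhd (fun w hw =>
      (differentiableAt_integral_cpow_mul_exp ha hw).differentiableWithinAt) hUo
  have h2 : AnalyticOnNhd ℂ (fun w => w ^ (-a) * Complex.Gamma a) U := by
    refine DifferentiableOn.analyticOnNhd (fun w hw => ?_) hUo
    refine DifferentiableAt.differentiableWithinAt (DifferentiableAt.mul_const ?_ _)
    exact differentiableAt_id.cpow_const (Or.inl hw)
  -- both sides are analytic in `w` and agree for real `w`
  refine h1.eqOn_of_preconnected_of_frequently_eq h2 hUc (z₀ := 1) (by simp [hU]) ?_ hw
  have h3 : Filter.Tendsto (fun k : ℕ => ((1 + 1 / ((k : ℝ) + 1) : ℝ) : ℂ)) Filter.atTop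
      (nhdsWithin 1 {1}ᶜ) := by
    refine tendsto_nhdsWithin_iff.2 ⟨?_, Filter.Eventually.of_forall fun k => ?_⟩
    · have h4 := (tendsto_one_div_add_atTop_nhds_zero_nat (𝕜 := ℝ)).const_add 1
      rw [add_zero] at h4
      exact (Complex.continuous_ofReal.tendsto 1).comp h4
    · have : (0 : ℝ) < 1 / ((k : ℝ) + 1) := by positivity
      intro h5
      have h6 : 1 + 1 / ((k : ℝ) + 1) = 1 := by
        exact_mod_cast Set.mem_singleton_iff.1 h5
      linarith
  refine h3.frequently (Filter.Frequently.of_forall fun k => ?_)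
  have hr : (0 : ℝ) < 1 + 1 / ((k : ℝ) + 1) := by positivity
  rw [Complex.integral_cpow_mul_exp_neg_mul_Ioi ha hr, one_div, Complex.cpow_neg,
    Complex.inv_cpow _ _ (by rw [Complex.arg_ofReal_of_nonneg hr.le]; exact Real.pi_pos.ne)]

/-! ### Sums over multi-indices -/

/-- The distributive law for products of `n` absolutely convergent series. -/
theorem summable_and_hasSum_prod_pi (n : ℕ) (f : Fin n → ℕ → ℂ)
    (hf : ∀ j, Summable fun k => ‖f j k‖) :
    (Summable fun m : Fin n → ℕ => ‖∏ j, f j (m j)‖) ∧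
      HasSum (fun m : Fin n → ℕ => ∏ j, f j (m j)) (∏ j, ∑' k, f j k) := by
  induction n with
  | zero =>
    refine ⟨(hasSum_fintype _).summable, ?_⟩
    simp only [Finset.univ_eq_empty, Finset.prod_empty]
    exact hasSum_unique fun _ => 1
  | succ n ih =>
    obtain ⟨h1, h2⟩ := ih (fun j => f j.succ) fun j => hf j.succ
    set g : (Fin n → ℕ) → ℂ := fun m => ∏ j, f j.succ (m j) with hg
    change Summable fun m => ‖g m‖ at h1
    change HasSum g _ at h2
    have h3 : Summable fun x : ℕ × (Fin n → ℕ) => ‖f 0 x.1 * g x.2‖ := (hf 0).mul_norm h1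
    have h4 := (hf 0).of_norm.hasSum.mul h2 h3.of_norm
    have he : ∀ x : ℕ × (Fin n → ℕ), ∏ j, f j ((Fin.consEquiv fun _ => ℕ) x j) =
        f 0 x.1 * g x.2 := by
      intro x
      rw [Fin.prod_univ_succ]
      simp [Fin.consEquiv, hg]
    constructor
    · rw [← (Fin.consEquiv fun _ : Fin (n + 1) => ℕ).summable_iff]
      exact h3.congr fun x => by rw [Function.comp_apply, he]
    · rw [← (Fin.consEquiv fun _ : Fin (n + 1) => ℕ).hasSum_iff, Fin.prod_univ_succ]
      convert! h4 using 1
      funext x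
      exact he x

/-- Absolute convergence of the Barnes series for `Re s > n`, by comparison of
`(1 + m₁ + ⋯ + mₙ)ⁿ` with `∏ (1 + mⱼ)`. -/
theorem summable_linear_rpow {n : ℕ} (hn : 0 < n) {a : ℝ} {ω : Fin n → ℝ} (ha : 0 < a)
    (hω : ∀ j, 0 < ω j) {σ : ℝ} (hσ : n < σ) :
    Summable fun m : Fin n → ℕ => (a + ∑ j, ω j * (m j : ℝ)) ^ (-σ) := by
  have hn' : (0 : ℝ) < n := by exact_mod_cast hn
  have hσ0 : 0 < σ := by linarith
  obtain ⟨c, hc0, hca, hcω⟩ : ∃ c : ℝ, 0 < c ∧ c ≤ a ∧ ∀ j, c ≤ ω j := by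
    obtain ⟨i, hi⟩ := Finite.exists_min (fun i : Option (Fin n) => i.elim a ω)
    refine ⟨i.elim a ω, ?_, hi none, fun j => hi (some j)⟩
    cases i with
    | none => exact ha
    | some j => exact hω j
  have hbase : Summable fun m : Fin n → ℕ => ∏ j, ((m j : ℝ) + 1) ^ (-(σ / n)) := by
    have h1 : Summable fun k : ℕ => ((k : ℝ) + 1) ^ (-(σ / n)) := by
      have h2 : Summable fun k : ℕ => (k : ℝ) ^ (-(σ / n)) :=
        Real.summable_nat_rpow.2 (by rw [neg_lt_neg_iff, one_lt_div hn']; exact hσ)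
      simpa using (summable_nat_add_iff 1).2 h2
    have h3 := (summable_and_hasSum_prod_pi n
      (fun _ k => ((((k : ℝ) + 1) ^ (-(σ / n)) : ℝ) : ℂ)) fun _ => by
        simpa only [Complex.norm_real] using h1.norm).1
    refine h3.congr fun m => ?_
    rw [← Complex.ofReal_prod, Complex.norm_real, Real.norm_of_nonneg]
    exact Finset.prod_nonneg fun j _ => by positivity
  refine Summable.of_nonneg_of_le (fun m => ?_) (fun m => ?_) (hbase.mul_left (c ^ (-σ)))
  · have : 0 ≤ ∑ j, ω j * (m j : ℝ) := Finset.sum_nonneg fun j _ =>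
      mul_nonneg (hω j).le (Nat.cast_nonneg _)
    positivity
  · set S : ℝ := 1 + ∑ j, (m j : ℝ) with hS
    have hS0 : 0 < S := by positivity
    have h1 : c * S ≤ a + ∑ j, ω j * (m j : ℝ) := by
      rw [hS, mul_add, mul_one, Finset.mul_sum]
      exact add_le_add hca (Finset.sum_le_sum fun j _ =>
        mul_le_mul_of_nonneg_right (hcω j) (Nat.cast_nonneg _))
    have h2 : ∏ j, ((m j : ℝ) + 1) ≤ S ^ (n : ℝ) := by
      rw [Real.rpow_natCast]
      have h3 : ∏ j, ((m j : ℝ) + 1) ≤ ∏ _j : Fin n, S := by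
        refine Finset.prod_le_prod (fun j _ => by positivity) fun j _ => ?_
        have h4 : (m j : ℝ) ≤ ∑ j, (m j : ℝ) :=
          Finset.single_le_sum (f := fun j => (m j : ℝ)) (fun i _ => Nat.cast_nonneg _)
            (Finset.mem_univ j)
        linarith
      simpa using h3
    have hP : 0 < ∏ j, ((m j : ℝ) + 1) := Finset.prod_pos fun j _ => by positivity
    calc (a + ∑ j, ω j * (m j : ℝ)) ^ (-σ) ≤ (c * S) ^ (-σ) :=
          Real.rpow_le_rpow_of_nonpos (by positivity) h1 (by linarith)
      _ = c ^ (-σ) * (S ^ (n : ℝ)) ^ (-(σ / n)) := by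
          rw [Real.mul_rpow hc0.le hS0.le, ← Real.rpow_mul hS0.le]
          congr 2
          field_simp
      _ ≤ c ^ (-σ) * (∏ j, ((m j : ℝ) + 1)) ^ (-(σ / n)) := by
          gcongr ?_ * ?_
          refine Real.rpow_le_rpow_of_nonpos hP h2 ?_
          rw [neg_nonpos]
          positivity
      _ = _ := by
          rw [Real.finsetProd_rpow _ _ fun j _ => by positivity]

/-! ### Meromorphic continuation of Mellin transforms -/

/-- `f` with the first `K` terms `c k * t ^ (k - n)` of its expansion at `0` subtracted on
`(0, 1]`. -/
noncomputable def mellinRemainder (f : ℝ → ℂ) (n : ℕ) (c : ℕ → ℂ) (K : ℕ) (t : ℝ) : ℂ :=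
  f t - ∑ k ∈ Finset.range K,
    c k * Set.indicator (Set.Ioc 0 1) (fun t : ℝ => (t : ℂ) ^ ((k : ℂ) - n)) t

/-- `f` is continuous on `(0, ∞)`, decays exponentially at infinity, and has the asymptotic
expansion `∑ₖ c k * t ^ (k - n)` at `0`. -/
structure HasMellinExpansion (f : ℝ → ℂ) (n : ℕ) (c : ℕ → ℂ) : Prop where
  continuousOn : ContinuousOn f (Set.Ioi 0)
  exists_isBigO_top : ∃ b : ℝ, 0 < b ∧ f =O[Filter.atTop] fun t => Real.exp (-b * t)
  isBigO_zero : ∀ K : ℕ, (fun t : ℝ => f t - ∑ k ∈ Finset.range K, c k * (t : ℂ) ^ ((k : ℂ) - n))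
    =O[nhdsWithin 0 (Set.Ioi 0)] fun t => t ^ ((K : ℝ) - n)

/-- The continued Mellin transform on the half-plane `Re s > n - K`. -/
noncomputable def mellinPartial (f : ℝ → ℂ) (n : ℕ) (c : ℕ → ℂ) (K : ℕ) (s : ℂ) : ℂ :=
  mellin (mellinRemainder f n c K) s + ∑ k ∈ Finset.range K, c k * (s + k - n)⁻¹

/-- The continuation of the Mellin transform to `ℂ`: the number of subtracted terms is chosen so
that the remaining integral converges at `s`. -/
noncomputable def mellinContinuation (f : ℝ → ℂ) (n : ℕ) (c : ℕ → ℂ) (s : ℂ) : ℂ :=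
  mellinPartial f n c (⌈(n : ℝ) - s.re⌉₊ + 1) s

namespace HasMellinExpansion

variable {f : ℝ → ℂ} {n : ℕ} {c : ℕ → ℂ}

theorem locallyIntegrableOn_remainder (h : HasMellinExpansion f n c) (K : ℕ) :
    MeasureTheory.LocallyIntegrableOn (mellinRemainder f n c K) (Set.Ioi 0) := by
  have h1 : MeasureTheory.LocallyIntegrableOn f (Set.Ioi 0) :=
    h.continuousOn.locallyIntegrableOn measurableSet_Ioi
  have h2 : ∀ k : ℕ, MeasureTheory.LocallyIntegrableOn
      (fun t => c k * Set.indicator (Set.Ioc 0 1) (fun t : ℝ => (t : ℂ) ^ ((k : ℂ) - n)) t)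
      (Set.Ioi 0) := by
    intro k
    have h3 : ContinuousOn (fun t : ℝ => c k * (t : ℂ) ^ ((k : ℂ) - n)) (Set.Ioi 0) := by
      refine fun t ht => ContinuousAt.continuousWithinAt (ContinuousAt.mul (by fun_prop) ?_)
      exact ContinuousAt.cpow (by fun_prop) (by fun_prop) (Or.inl (by simpa using ht))
    have h4 := h3.locallyIntegrableOn (μ := MeasureTheory.volume) measurableSet_Ioi
    have h5 : (fun t => c k * Set.indicator (Set.Ioc 0 1) (fun t : ℝ => (t : ℂ) ^ ((k : ℂ) - n)) t)
        = Set.indicator (Set.Ioc 0 1) (fun t : ℝ => c k * (t : ℂ) ^ ((k : ℂ) - n)) := by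
      funext t
      by_cases ht : t ∈ Set.Ioc (0 : ℝ) 1
      · rw [Set.indicator_of_mem ht, Set.indicator_of_mem ht]
      · rw [Set.indicator_of_notMem ht, Set.indicator_of_notMem ht, mul_zero]
    rw [h5]
    intro t ht
    obtain ⟨u, hu, hi⟩ := h4 t ht
    exact ⟨u, hu, hi.indicator measurableSet_Ioc⟩
  intro t ht
  refine MeasureTheory.IntegrableAtFilter.sub (h1 t ht) ?_
  induction K with
  | zero =>
    simp only [Finset.range_zero, Finset.sum_empty]
    exact (MeasureTheory.integrable_zero ℝ ℂ MeasureTheory.volume).integrableAtFilter _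
  | succ K ih =>
    simp only [Finset.sum_range_succ]
    exact ih.add (h2 K t ht)

theorem isBigO_top_remainder (h : HasMellinExpansion f n c) (K : ℕ) :
    ∃ b : ℝ, 0 < b ∧ mellinRemainder f n c K =O[Filter.atTop] fun t => Real.exp (-b * t) := by
  obtain ⟨b, hb, hO⟩ := h.exists_isBigO_top
  refine ⟨b, hb, hO.congr' ?_ Filter.EventuallyEq.rfl⟩
  filter_upwards [Filter.eventually_gt_atTop 1] with t ht
  rw [mellinRemainder, Finset.sum_eq_zero, sub_zero]
  intro k _
  rw [Set.indicator_of_notMem (fun h => absurd h.2 (not_le.2 ht)), mul_zero]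

theorem isBigO_zero_remainder (h : HasMellinExpansion f n c) (K : ℕ) :
    mellinRemainder f n c K =O[nhdsWithin 0 (Set.Ioi 0)] fun t => t ^ (-((n : ℝ) - K)) := by
  have h1 := h.isBigO_zero K
  rw [neg_sub]
  refine h1.congr' ?_ Filter.EventuallyEq.rfl
  filter_upwards [Ioc_mem_nhdsGT one_pos] with t ht
  simp only [mellinRemainder, Set.indicator_of_mem ht]

theorem differentiableAt_remainder (h : HasMellinExpansion f n c) {K : ℕ} {s : ℂ}
    (hs : (n : ℝ) - K < s.re) : DifferentiableAt ℂ (mellin (mellinRemainder f n c K)) s := by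
  obtain ⟨b, hb, hO⟩ := h.isBigO_top_remainder K
  exact mellin_differentiableAt_of_isBigO_rpow_exp hb (h.locallyIntegrableOn_remainder K) hO
    (h.isBigO_zero_remainder K) hs

theorem mellinConvergent_remainder (h : HasMellinExpansion f n c) {K : ℕ} {s : ℂ}
    (hs : (n : ℝ) - K < s.re) : MellinConvergent (mellinRemainder f n c K) s := by
  obtain ⟨b, hb, hO⟩ := h.isBigO_top_remainder K
  exact mellinConvergent_of_isBigO_rpow_exp hb (h.locallyIntegrableOn_remainder K) hO
    (h.isBigO_zero_remainder K) hs

theorem mellinPartial_succ (h : HasMellinExpansion f n c) {K : ℕ} {s : ℂ}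
    (hs : (n : ℝ) - K < s.re) : mellinPartial f n c (K + 1) s = mellinPartial f n c K s := by
  have h1 := hasMellin_cpow_Ioc ((K : ℂ) - n) (s := s) (by simp; linarith)
  have h2 := hasMellin_const_smul h1.1 (c K)
  have h3 := hasMellin_sub (h.mellinConvergent_remainder hs) h2.1
  have h4 : mellinRemainder f n c (K + 1) = fun t => mellinRemainder f n c K t -
      c K • Set.indicator (Set.Ioc 0 1) (fun t : ℝ => (t : ℂ) ^ ((K : ℂ) - n)) t := by
    funext t
    rw [mellinRemainder, mellinRemainder, Finset.sum_range_succ, smul_eq_mul]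
    ring
  rw [mellinPartial, mellinPartial, h4, h3.2, h2.2, h1.2, Finset.sum_range_succ, smul_eq_mul,
    one_div, add_sub_assoc s]
  ring

theorem mellinPartial_eq (h : HasMellinExpansion f n c) {K L : ℕ} (hKL : K ≤ L) {s : ℂ}
    (hs : (n : ℝ) - K < s.re) : mellinPartial f n c L s = mellinPartial f n c K s := by
  induction L, hKL using Nat.le_induction with
  | base => rfl
  | succ L hL ih =>
    have : (K : ℝ) ≤ L := by exact_mod_cast hL
    rw [h.mellinPartial_succ (by linarith), ih]

theorem mellinContinuation_eq (h : HasMellinExpansion f n c) {K : ℕ} {s : ℂ}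
    (hs : (n : ℝ) - K < s.re) : mellinContinuation f n c s = mellinPartial f n c K s := by
  have h1 : (n : ℝ) - (⌈(n : ℝ) - s.re⌉₊ + 1 : ℕ) < s.re := by
    have := Nat.le_ceil ((n : ℝ) - s.re)
    push_cast
    linarith
  rw [mellinContinuation]
  rcases le_total K (⌈(n : ℝ) - s.re⌉₊ + 1) with hK | hK
  · exact h.mellinPartial_eq hK hs
  · exact (h.mellinPartial_eq hK h1).symm

theorem mellinContinuation_eq_mellin (h : HasMellinExpansion f n c) {s : ℂ}
    (hs : (n : ℝ) < s.re) : mellinContinuation f n c s = mellin f s := by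
  rw [h.mellinContinuation_eq (K := 0) (by simpa using hs), mellinPartial]
  simp only [Finset.range_zero, Finset.sum_empty, add_zero]
  congr 1
  funext t
  simp [mellinRemainder]

theorem eventually_mellinContinuation_eq (h : HasMellinExpansion f n c) {K : ℕ} {s : ℂ}
    (hs : (n : ℝ) - K < s.re) :
    mellinContinuation f n c =ᶠ[nhds s] mellinPartial f n c K := by
  have ho : IsOpen {s : ℂ | (n : ℝ) - K < s.re} := isOpen_lt continuous_const Complex.continuous_re
  filter_upwards [ho.mem_nhds hs] with z hz
  exact h.mellinContinuation_eq hz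

theorem analyticAt_remainder (h : HasMellinExpansion f n c) {K : ℕ} {s : ℂ}
    (hs : (n : ℝ) - K < s.re) : AnalyticAt ℂ (mellin (mellinRemainder f n c K)) s := by
  have ho : IsOpen {s : ℂ | (n : ℝ) - K < s.re} := isOpen_lt continuous_const Complex.continuous_re
  rw [Complex.analyticAt_iff_eventually_differentiableAt]
  filter_upwards [ho.mem_nhds hs] with z hz
  exact h.differentiableAt_remainder hz

theorem meromorphicAt_mellinContinuation (h : HasMellinExpansion f n c) (s : ℂ) :
    MeromorphicAt (mellinContinuation f n c) s := by
  obtain ⟨K, hK⟩ := exists_nat_gt ((n : ℝ) - s.re)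
  have hs : (n : ℝ) - K < s.re := by linarith
  refine MeromorphicAt.congr ?_
    ((h.eventually_mellinContinuation_eq hs).symm.filter_mono nhdsWithin_le_nhds)
  refine (h.analyticAt_remainder hs).meromorphicAt.add (MeromorphicAt.fun_sum fun k _ => ?_)
  exact (MeromorphicAt.const _ _).mul
    (MeromorphicAt.inv (f := fun s : ℂ => s + k - n) (AnalyticAt.meromorphicAt (by fun_prop)))

theorem continuousAt_mellinContinuation (h : HasMellinExpansion f n c) {s : ℂ}
    (hs : (n : ℝ) < s.re) : ContinuousAt (mellinContinuation f n c) s := by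
  have hs' : (n : ℝ) - (0 : ℕ) < s.re := by simpa using hs
  refine ContinuousAt.congr ?_ (h.eventually_mellinContinuation_eq hs').symm
  have h1 : mellinPartial f n c 0 = mellin (mellinRemainder f n c 0) := by
    funext s
    simp [mellinPartial]
  rw [h1]
  exact (h.differentiableAt_remainder hs').continuousAt

/-- At `-N` the continued Mellin transform has at most a simple pole, with residue the coefficient
of `t ^ N`. -/
theorem tendsto_mul_mellinContinuation (h : HasMellinExpansion f n c) (N : ℕ) :
    Filter.Tendsto (fun s => (s + N) * mellinContinuation f n c s)
      (nhdsWithin (-(N : ℂ)) {-(N : ℂ)}ᶜ) (nhds (c (n + N))) := by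
  have hs : (n : ℝ) - (n + N + 1 : ℕ) < (-(N : ℂ)).re := by
    push_cast
    simp
    linarith
  have h1 : Filter.Tendsto (fun s => (s + N) * (mellin (mellinRemainder f n c (n + N + 1)) s +
      ∑ k ∈ Finset.range (n + N), c k * (s + k - n)⁻¹))
      (nhdsWithin (-(N : ℂ)) {-(N : ℂ)}ᶜ) (nhds 0) := by
    have h2 : ContinuousAt (fun s => (s + N) * (mellin (mellinRemainder f n c (n + N + 1)) s +
        ∑ k ∈ Finset.range (n + N), c k * (s + k - n)⁻¹)) (-(N : ℂ)) := by
      refine ContinuousAt.mul (by fun_prop)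
        ((h.differentiableAt_remainder hs).continuousAt.add ?_)
      refine tendsto_finsetSum _ fun k hk => ?_
      refine ContinuousAt.mul (by fun_prop) (ContinuousAt.inv₀ (by fun_prop) ?_)
      have hk' := Finset.mem_range.1 hk
      intro h3
      have h4 : (k : ℂ) = ((n + N : ℕ) : ℂ) := by
        push_cast
        linear_combination h3
      exact hk'.ne (by exact_mod_cast h4)
    simpa using h2.tendsto.mono_left (nhdsWithin_le_nhds (s := {-(N : ℂ)}ᶜ))
  have h5 := h1.add_const (c (n + N))
  rw [zero_add] at h5
  refine h5.congr' ?_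
  filter_upwards [self_mem_nhdsWithin,
    (h.eventually_mellinContinuation_eq hs).filter_mono nhdsWithin_le_nhds] with s hs1 hs2
  have hs3 : s + N ≠ 0 := fun h6 => hs1 (eq_neg_of_add_eq_zero_left h6)
  rw [hs2, mellinPartial, Finset.sum_range_succ,
    show s + ((n + N : ℕ) : ℂ) - n = s + N by push_cast; ring]
  field_simp
  ring

end HasMellinExpansion

/-- The residue of the Gamma function at `-N` is `(-1)^N / N!`. -/
theorem tendsto_mul_Gamma_neg_nat (N : ℕ) :
    Filter.Tendsto (fun s => (s + N) * Complex.Gamma s) (nhdsWithin (-(N : ℂ)) {-(N : ℂ)}ᶜ)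
      (nhds ((-1) ^ N / (N.factorial : ℂ))) := by
  induction N with
  | zero => simpa using Complex.tendsto_self_mul_Gamma_nhds_zero
  | succ N ih =>
    have h1 : Filter.Tendsto (fun s : ℂ => s + 1)
        (nhdsWithin (-((N + 1 : ℕ) : ℂ)) {-((N + 1 : ℕ) : ℂ)}ᶜ)
        (nhdsWithin (-(N : ℂ)) {-(N : ℂ)}ᶜ) := by
      refine tendsto_nhdsWithin_iff.2 ⟨?_, ?_⟩
      · have h2 : Filter.Tendsto (fun s : ℂ => s + 1) (nhds (-((N + 1 : ℕ) : ℂ)))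
            (nhds (-((N + 1 : ℕ) : ℂ) + 1)) := Continuous.tendsto (by fun_prop) _
        rw [show -((N + 1 : ℕ) : ℂ) + 1 = -(N : ℂ) by push_cast; ring] at h2
        exact h2.mono_left nhdsWithin_le_nhds
      · filter_upwards [self_mem_nhdsWithin] with s hs hs'
        refine hs ?_
        rw [Set.mem_singleton_iff] at hs' ⊢
        push_cast
        linear_combination hs'
    have hne : -((N + 1 : ℕ) : ℂ) ≠ 0 := neg_ne_zero.2 (by exact_mod_cast N.succ_ne_zero)
    have h3 : Filter.Tendsto (fun s : ℂ => s⁻¹)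
        (nhdsWithin (-((N + 1 : ℕ) : ℂ)) {-((N + 1 : ℕ) : ℂ)}ᶜ)
        (nhds (-((N + 1 : ℕ) : ℂ))⁻¹) :=
      (tendsto_inv₀ hne).mono_left nhdsWithin_le_nhds
    have h4 := (ih.comp h1).mul h3
    have h5 : (-1) ^ N / (N.factorial : ℂ) * (-((N + 1 : ℕ) : ℂ))⁻¹ =
        (-1) ^ (N + 1) / ((N + 1).factorial : ℂ) := by
      have h6 : ((N + 1 : ℕ) : ℂ) ≠ 0 := by exact_mod_cast N.succ_ne_zero
      have h7 : (N.factorial : ℂ) ≠ 0 := by exact_mod_cast N.factorial_ne_zero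
      rw [Nat.factorial_succ, Nat.cast_mul, inv_neg, pow_succ]
      field_simp
    rw [h5] at h4
    refine h4.congr' ?_
    filter_upwards [nhdsWithin_le_nhds (isOpen_ne.mem_nhds hne)] with s hs
    rw [Function.comp_apply, Complex.Gamma_add_one s hs]
    push_cast
    field_simp
    ring

/-- Dividing the continued Mellin transform by `Γ` removes the pole at `-N`. -/
theorem HasMellinExpansion.tendsto_div_Gamma {f : ℝ → ℂ} {n : ℕ} {c : ℕ → ℂ}
    (h : HasMellinExpansion f n c) (N : ℕ) :
    Filter.Tendsto (fun s => mellinContinuation f n c s / Complex.Gamma s)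
      (nhdsWithin (-(N : ℂ)) {-(N : ℂ)}ᶜ) (nhds ((-1) ^ N * N.factorial * c (n + N))) := by
  have hN : (N.factorial : ℂ) ≠ 0 := by exact_mod_cast N.factorial_ne_zero
  have h1 := (h.tendsto_mul_mellinContinuation N).div (tendsto_mul_Gamma_neg_nat N)
    (div_ne_zero (pow_ne_zero N (neg_ne_zero.2 one_ne_zero)) hN)
  have h2 : c (n + N) / ((-1) ^ N / (N.factorial : ℂ)) = (-1) ^ N * N.factorial * c (n + N) := by
    have h3 : ((-1 : ℂ) ^ N) * (-1) ^ N = 1 := by rw [← mul_pow]; simp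
    have h4 : ((-1 : ℂ) ^ N) ≠ 0 := pow_ne_zero N (neg_ne_zero.2 one_ne_zero)
    rw [div_div_eq_mul_div, div_eq_iff h4]
    linear_combination (-(c (n + N) * N.factorial)) * h3
  rw [h2] at h1
  refine h1.congr' ?_
  filter_upwards [self_mem_nhdsWithin] with s hs
  have hs' : s + N ≠ 0 := fun h6 => hs (eq_neg_of_add_eq_zero_left h6)
  exact mul_div_mul_left _ _ hs'

/-! ### The Barnes zeta-function -/

/-- The kernel `e^{-at} ∏ⱼ (1 - e^{-ωⱼt})⁻¹`, whose Mellin transform is `Γ(s) ζₙ(s, a; ω)`. -/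
noncomputable def barnesKernel {n : ℕ} (a : ℂ) (ω : Fin n → ℂ) (t : ℝ) : ℂ :=
  Complex.exp (-(a * t)) * ∏ j, (1 - Complex.exp (-(ω j * t)))⁻¹

theorem norm_exp_neg_mul_lt_one {w : ℂ} (hw : 0 < w.re) {t : ℝ} (ht : 0 < t) :
    ‖Complex.exp (-(w * t))‖ < 1 := by
  rw [Complex.norm_exp, Real.exp_lt_one_iff]
  simpa using mul_pos hw ht

theorem hasSum_barnesKernel {n : ℕ} (a : ℂ) {ω : Fin n → ℂ} (hω : ∀ j, 0 < (ω j).re) {t : ℝ}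
    (ht : 0 < t) :
    HasSum (fun m : Fin n → ℕ => Complex.exp (-((a + ∑ j, ω j * (m j : ℂ)) * t)))
      (barnesKernel a ω t) := by
  have h1 := (summable_and_hasSum_prod_pi n (fun j k => Complex.exp (-(ω j * t)) ^ k) fun j => by
    simpa only [norm_pow] using summable_geometric_of_lt_one (norm_nonneg _)
      (norm_exp_neg_mul_lt_one (hω j) ht)).2
  simp only [tsum_geometric_of_norm_lt_one (norm_exp_neg_mul_lt_one (hω _) ht)] at h1
  refine (h1.mul_left (Complex.exp (-(a * t)))).congr_fun ?_
  intro m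
  simp only [← Complex.exp_nat_mul]
  rw [← Complex.exp_sum, ← Complex.exp_add, add_mul, neg_add, Finset.sum_mul,
    ← Finset.sum_neg_distrib]
  congr 2
  exact Finset.sum_congr rfl fun j _ => by ring

theorem re_linear_pos {n : ℕ} {a : ℂ} {ω : Fin n → ℂ} (ha : 0 < a.re) (hω : ∀ j, 0 < (ω j).re)
    (m : Fin n → ℕ) : 0 < (a + ∑ j, ω j * (m j : ℂ)).re := by
  rw [Complex.add_re, Complex.re_sum]
  have : 0 ≤ ∑ j, (ω j * (m j : ℂ)).re := Finset.sum_nonneg fun j _ => by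
    simpa using mul_nonneg (hω j).le (Nat.cast_nonneg (m j))
  linarith

/-- For periods in the right half-plane, the Mellin transform of the kernel is `Γ(s)` times the
Barnes series. -/
theorem hasSum_mellin_barnesKernel {n : ℕ} (hn : 0 < n) {a : ℂ} {ω : Fin n → ℂ} (ha : 0 < a.re)
    (hω : ∀ j, 0 < (ω j).re) {s : ℂ} (hs : (n : ℝ) < s.re) :
    HasSum (fun m : Fin n → ℕ => (a + ∑ j, ω j * (m j : ℂ)) ^ (-s) * Complex.Gamma s)
      (mellin (barnesKernel a ω) s) := by
  have hs0 : 0 < s.re := lt_of_le_of_lt (Nat.cast_nonneg n) hs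
  set w : (Fin n → ℕ) → ℂ := fun m => a + ∑ j, ω j * (m j : ℂ) with hw
  have hwpos : ∀ m, 0 < (w m).re := re_linear_pos ha hω
  set F : (Fin n → ℕ) → ℝ → ℂ := fun m t => (t : ℂ) ^ (s - 1) * Complex.exp (-(w m * t)) with hF
  have h1 := MeasureTheory.hasSum_integral_of_summable_integral_norm
    (μ := MeasureTheory.volume.restrict (Set.Ioi 0)) (F := F)
    (fun m => integrableOn_cpow_mul_exp hs0 (hwpos m)) ?_
  · have h2 : ∀ m, ∫ t in Set.Ioi 0, F m t = w m ^ (-s) * Complex.Gamma s := fun m =>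
      integral_cpow_mul_exp_neg_mul_complex hs0 (hwpos m)
    simp only [h2] at h1
    convert! h1 using 1
    rw [mellin]
    refine MeasureTheory.setIntegral_congr_fun measurableSet_Ioi fun t ht => ?_
    simp only [hF, smul_eq_mul]
    exact (((hasSum_barnesKernel a hω ht).mul_left ((t : ℂ) ^ (s - 1))).tsum_eq).symm
  · have h3 : ∀ m, ∫ t in Set.Ioi 0, ‖F m t‖ =
        (a.re + ∑ j, (ω j).re * (m j : ℝ)) ^ (-s.re) * Real.Gamma s.re := by
      intro m
      rw [MeasureTheory.setIntegral_congr_fun measurableSet_Ioi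
        (fun t ht => norm_cpow_mul_exp (a := s) (w := w m) ht),
        Real.integral_rpow_mul_exp_neg_mul_Ioi hs0 (hwpos m), one_div,
        Real.inv_rpow (hwpos m).le, ← Real.rpow_neg (hwpos m).le]
      congr 2
      simp [hw]
    simp only [h3]
    exact (summable_linear_rpow hn ha hω hs).mul_right _

/-- If `h` is analytic at `0` and the kernel is `h t / t ^ n`, then the Taylor coefficients of `h`
govern the kernel at `0`. -/
theorem hasMellinExpansion_barnesKernel {n : ℕ} {a : ℂ} {ω : Fin n → ℂ} (ha : 0 < a.re)
    (hω : ∀ j, 0 < (ω j).re) {h : ℂ → ℂ} (hh : AnalyticAt ℂ h 0)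
    (hk : ∀ t : ℝ, 0 < t → barnesKernel a ω t = h t / (t : ℂ) ^ n) :
    HasMellinExpansion (barnesKernel a ω) n fun k => PowerSeries.coeff k (taylorSeries h) where
  continuousOn := by
    intro t ht
    refine ContinuousAt.continuousWithinAt (ContinuousAt.mul (by fun_prop) ?_)
    refine tendsto_finsetProd _ fun j _ => ?_
    refine ContinuousAt.inv₀ (by fun_prop) fun h0 => ?_
    have h1 := norm_exp_neg_mul_lt_one (hω j) ht
    rw [← sub_eq_zero.1 h0, norm_one] at h1
    exact lt_irrefl _ h1
  exists_isBigO_top := by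
    refine ⟨a.re, ha, ?_⟩
    have h1 : Filter.Tendsto (fun t : ℝ => ∏ j, (1 - Complex.exp (-(ω j * t)))⁻¹) Filter.atTop
        (nhds (∏ _j : Fin n, (1 - 0)⁻¹)) := by
      refine tendsto_finsetProd _ fun j _ => ?_
      refine Filter.Tendsto.inv₀ (tendsto_const_nhds.sub ?_) (by simp)
      rw [tendsto_zero_iff_norm_tendsto_zero]
      have h2 : ∀ t : ℝ, ‖Complex.exp (-(ω j * t))‖ = Real.exp (-((ω j).re * t)) := fun t => by
        rw [Complex.norm_exp]; simp
      simp only [h2]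
      exact Real.tendsto_exp_neg_atTop_nhds_zero.comp (Filter.tendsto_id.const_mul_atTop (hω j))
    have h3 : (fun t : ℝ => Complex.exp (-(a * t))) =O[Filter.atTop]
        fun t => Real.exp (-a.re * t) :=
      Asymptotics.IsBigO.of_bound 1 (Filter.Eventually.of_forall fun t => by
        rw [Complex.norm_exp, one_mul, Real.norm_of_nonneg (Real.exp_pos _).le]; simp)
    exact (h3.mul (h1.isBigO_one ℝ)).congr_right fun t => mul_one _
  isBigO_zero := by
    intro K
    have h1 : Filter.Tendsto (fun t : ℝ => (t : ℂ)) (nhdsWithin 0 (Set.Ioi 0)) (nhds 0) :=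
      (Complex.continuous_ofReal.tendsto 0).mono_left nhdsWithin_le_nhds
    have h2 := (isBigO_sub_taylorSeries hh K).comp_tendsto h1
    have h3 := (Asymptotics.isBigO_refl (fun t : ℝ => ((t : ℂ) ^ n)⁻¹)
      (nhdsWithin 0 (Set.Ioi 0))).mul h2
    refine Asymptotics.IsBigO.congr' (h3.trans ?_) ?_ Filter.EventuallyEq.rfl
    · refine Asymptotics.IsBigO.of_bound 1 ?_
      filter_upwards [self_mem_nhdsWithin] with t ht
      have ht' : (0 : ℝ) < t := ht
      rw [Function.comp_apply, norm_mul, norm_inv, norm_pow, norm_pow, Complex.norm_real,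
        Real.norm_of_nonneg ht'.le, one_mul, Real.norm_of_nonneg (Real.rpow_nonneg ht'.le _),
        Real.rpow_sub ht', Real.rpow_natCast, Real.rpow_natCast, div_eq_inv_mul]
    · filter_upwards [self_mem_nhdsWithin] with t ht
      have ht' : (t : ℂ) ≠ 0 := by exact_mod_cast (ne_of_gt ht)
      rw [Function.comp_apply, hk t ht, mul_sub, Finset.mul_sum, inv_mul_eq_div]
      congr 1
      refine Finset.sum_congr rfl fun k _ => ?_
      rw [Complex.cpow_sub _ _ ht', Complex.cpow_natCast, Complex.cpow_natCast]
      field_simp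

theorem toMeromorphicNFOn_of_tendsto {f : ℂ → ℂ} (hf : MeromorphicOn f Set.univ) {x L : ℂ}
    (h : Filter.Tendsto f (nhdsWithin x {x}ᶜ) (nhds L)) :
    AnalyticAt ℂ (toMeromorphicNFOn f Set.univ) x ∧ toMeromorphicNFOn f Set.univ x = L := by
  have hx := Set.mem_univ x
  have h1 : AnalyticAt ℂ (toMeromorphicNFOn f Set.univ) x := by
    rw [← (meromorphicNFOn_toMeromorphicNFOn f Set.univ hx).meromorphicOrderAt_nonneg_iff_analyticAt,
      meromorphicOrderAt_toMeromorphicNFOn hf hx,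
      ← tendsto_nhds_iff_meromorphicOrderAt_nonneg (hf x hx)]
    exact ⟨L, h⟩
  refine ⟨h1, tendsto_nhds_unique
    (h1.continuousAt.tendsto.mono_left (nhdsWithin_le_nhds (s := {x}ᶜ))) ?_⟩
  exact h.congr' (hf.toMeromorphicNFOn_eq_self_on_nhdsNE hx).symm

/-- Principal powers of points in the half-plane `Re (e^{-iθ} w) > 0` through powers of points in
the right half-plane. -/
theorem cpow_eq_of_rotation {θ : ℝ} (hθ : |θ| < π / 2) {w : ℂ}
    (hw : 0 < (Complex.exp (-(θ * Complex.I)) * w).re) (s : ℂ) :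
    w ^ (-s) = Complex.exp (-(θ * Complex.I) * s) *
      (Complex.exp (-(θ * Complex.I)) * w) ^ (-s) := by
  set v := Complex.exp (-(θ * Complex.I)) * w with hv
  have hv0 : v ≠ 0 := by
    intro h0
    rw [h0] at hw
    simp at hw
  have hwv : w = Complex.exp (θ * Complex.I + Complex.log v) := by
    rw [Complex.exp_add, Complex.exp_log hv0, hv, ← mul_assoc, ← Complex.exp_add]
    simp
  have hw0 : w ≠ 0 := by rw [hwv]; exact Complex.exp_ne_zero _
  have harg : |v.arg| < π / 2 := Complex.abs_arg_lt_pi_div_two_iff.2 (Or.inl hw)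
  rw [abs_lt] at hθ harg
  have hlog : Complex.log w = θ * Complex.I + Complex.log v := by
    conv_lhs => rw [hwv]
    apply Complex.log_exp
    · simp only [Complex.add_im, Complex.im_ofReal_mul, Complex.I_im,
        Complex.log_im]
      linarith
    · simp only [Complex.add_im, Complex.im_ofReal_mul, Complex.I_im,
        Complex.log_im]
      linarith
  rw [Complex.cpow_def_of_ne_zero hw0, Complex.cpow_def_of_ne_zero hv0, ← Complex.exp_add, hlog]
  congr 1
  ring

/-- The Barnes zeta-function exists if `a` and the periods lie in a common half-plane
`Re (e^{-iθ} w) > 0`, and its values at the non-positive integers are given by the Taylor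
coefficients of the kernel. -/
theorem exists_isBarnesZeta {n : ℕ} (hn : 0 < n) {a : ℂ} {ω : Fin n → ℂ} {θ : ℝ}
    (hθ : |θ| < π / 2) (ha : 0 < (Complex.exp (-(θ * Complex.I)) * a).re)
    (hω : ∀ j, 0 < (Complex.exp (-(θ * Complex.I)) * ω j).re) {h : ℂ → ℂ} (hh : AnalyticAt ℂ h 0)
    (hk : ∀ t : ℝ, 0 < t → barnesKernel (Complex.exp (-(θ * Complex.I)) * a)
      (fun j => Complex.exp (-(θ * Complex.I)) * ω j) t = h t / (t : ℂ) ^ n) :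
    ∃ Z, IsBarnesZeta a ω Z ∧ ∀ N : ℕ, AnalyticAt ℂ Z (-(N : ℂ)) ∧
      Z (-(N : ℂ)) = Complex.exp (θ * Complex.I) ^ N *
        ((-1) ^ N * N.factorial * PowerSeries.coeff (n + N) (taylorSeries h)) := by
  set u := Complex.exp (-(θ * Complex.I)) with hu
  have hexp := hasMellinExpansion_barnesKernel ha hω hh hk
  set M := mellinContinuation (barnesKernel (u * a) fun j => u * ω j) n
    (fun k => PowerSeries.coeff k (taylorSeries h)) with hM
  set W : ℂ → ℂ := fun s => Complex.exp (-(θ * Complex.I) * s) * (M s / Complex.Gamma s) with hW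
  have hWm : MeromorphicOn W Set.univ := by
    intro s _
    refine (AnalyticAt.meromorphicAt (by fun_prop)).mul ?_
    have h1 : MeromorphicAt (fun s => (Complex.Gamma s)⁻¹) s :=
      (Complex.differentiable_one_div_Gamma.analyticAt s).meromorphicAt
    have h2 := (hexp.meromorphicAt_mellinContinuation s).mul h1
    exact h2
  refine ⟨toMeromorphicNFOn W Set.univ, ⟨meromorphicNFOn_toMeromorphicNFOn W Set.univ, ?_⟩, ?_⟩
  · intro s hs
    have hs0 : 0 < s.re := lt_of_le_of_lt (Nat.cast_nonneg n) hs
    have hΓ : Complex.Gamma s ≠ 0 := Complex.Gamma_ne_zero_of_re_pos hs0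
    have hc : ContinuousAt W s := by
      refine ContinuousAt.mul (by fun_prop) ?_
      have h1 := (hexp.continuousAt_mellinContinuation hs).mul
        (Complex.differentiable_one_div_Gamma.continuous.continuousAt (x := s))
      exact h1
    rw [(toMeromorphicNFOn_of_tendsto hWm (hc.tendsto.mono_left nhdsWithin_le_nhds)).2]
    have h2 := hasSum_mellin_barnesKernel hn ha hω hs
    rw [← hexp.mellinContinuation_eq_mellin hs] at h2
    refine ((h2.div_const (Complex.Gamma s)).mul_left
      (Complex.exp (-(θ * Complex.I) * s))).congr_fun fun m => ?_
    have h3 : u * (a + ∑ j, ω j * (m j : ℂ)) = u * a + ∑ j, u * ω j * (m j : ℂ) := by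
      rw [mul_add, Finset.mul_sum]
      simp only [mul_assoc]
    rw [mul_div_cancel_right₀ _ hΓ, ← h3]
    refine cpow_eq_of_rotation hθ ?_ s
    rw [← hu, h3]
    exact re_linear_pos ha hω m
  · intro N
    have h1 : ContinuousAt (fun s => Complex.exp (-(θ * Complex.I) * s)) (-(N : ℂ)) := by fun_prop
    have h2 := (h1.tendsto.mono_left (nhdsWithin_le_nhds (s := {-(N : ℂ)}ᶜ))).mul
      (hexp.tendsto_div_Gamma N)
    have h3 : Complex.exp (-(θ * Complex.I) * -(N : ℂ)) = Complex.exp (θ * Complex.I) ^ N := by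
      rw [← Complex.exp_nat_mul]
      congr 1
      ring
    rw [h3] at h2
    exact toMeromorphicNFOn_of_tendsto hWm h2

/-! ### Barnes zeta-functions with periods `1, η, …, η^{n-1}` -/

theorem bernoulliGen_one_sub_div (y x : ℂ) :
    bernoulliGen (1 - y) x / x = Complex.exp (-(y * x)) * (1 - Complex.exp (-x))⁻¹ := by
  have h1 : Complex.exp x - 1 = Complex.exp x * (1 - Complex.exp (-x)) := by
    rw [mul_sub, ← Complex.exp_add]
    simp
  have h2 : Complex.exp ((1 - y) * x) = Complex.exp x * Complex.exp (-(y * x)) := by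
    rw [← Complex.exp_add]
    congr 1
    ring
  rw [bernoulliGen, div_div, mul_comm (expSlope x), mul_expSlope, h1, h2,
    mul_div_mul_left _ _ (Complex.exp_ne_zero x), div_eq_mul_inv]

/-- The kernel belonging to `a = ∑ ωⱼ yⱼ` is a product of generating functions of Bernoulli
polynomials. -/
theorem barnesKernel_eq_prod {n : ℕ} (ω y : Fin n → ℂ) (t : ℝ) :
    barnesKernel (∑ j, ω j * y j) ω t =
      ((∏ j, ω j)⁻¹ * ∏ j, bernoulliGen (1 - y j) (ω j * t)) / (t : ℂ) ^ n := by
  have h1 : Complex.exp (-((∑ j, ω j * y j) * t)) =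
      ∏ j, Complex.exp (-(y j * (ω j * t))) := by
    rw [← Complex.exp_sum, Finset.sum_mul, Finset.sum_neg_distrib]
    congr 2
    exact Finset.sum_congr rfl fun j _ => by ring
  have h2 : ∏ j, (ω j * t) = (∏ j, ω j) * (t : ℂ) ^ n := by
    rw [Finset.prod_mul_distrib]
    simp
  rw [barnesKernel, h1, ← Finset.prod_mul_distrib,
    Finset.prod_congr rfl fun j _ =>
      (bernoulliGen_one_sub_div (y j) (ω j * t)).symm,
    Finset.prod_div_distrib, h2, inv_mul_eq_div, div_div]

theorem taylorSeries_bernoulliGen_rescale (y : ℝ) {c u : ℂ} (hc : c ≠ 0) (hu : u ≠ 0) :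
    (taylorSeries fun z => bernoulliGen y (u * c * z)) =
      PowerSeries.rescale u (taylorSeries fun z => bernoulliGen y (c * z)) := by
  ext k
  rw [coeff_taylorSeries_bernoulliGen _ (mul_ne_zero hu hc), PowerSeries.coeff_rescale,
    coeff_taylorSeries_bernoulliGen _ hc, mul_pow]
  ring

/-- The periods `1, η, …, η^{n-1}` lie in the half-plane around their bisector. -/
theorem re_rotated_etaRoot_pow_pos {n j : ℕ} (hj : j < n) :
    0 < (Complex.exp (-(((π * (n - 1) / (2 * n) : ℝ) : ℂ) * Complex.I)) * etaRoot n ^ j).re := by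
  have hn : (0 : ℝ) < n := by exact_mod_cast (by omega : 0 < n)
  have hj' : (j : ℝ) + 1 ≤ n := by exact_mod_cast hj
  have hj0 : (0 : ℝ) ≤ j := Nat.cast_nonneg j
  have hpi := Real.pi_pos
  have h1 : Complex.exp (-(((π * (n - 1) / (2 * n) : ℝ) : ℂ) * Complex.I)) * etaRoot n ^ j =
      Complex.exp (((π * (2 * j + 1 - n) / (2 * n) : ℝ) : ℂ) * Complex.I) := by
    rw [etaRoot_pow_eq, ← Complex.exp_add, ← neg_mul, ← add_mul, ← Complex.ofReal_neg,
      ← Complex.ofReal_add]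
    congr 3
    field_simp
    ring
  rw [h1, Complex.exp_ofReal_mul_I_re]
  apply Real.cos_pos_of_mem_Ioo
  constructor
  · rw [lt_div_iff₀ (by positivity)]
    nlinarith
  · rw [div_lt_iff₀ (by positivity)]
    nlinarith

theorem exists_isBarnesZeta_etaShift {n : ℕ} (hn : 0 < n) {y : ℝ} (hy0 : 0 < y) (hy1 : y < 1)
    (e : Fin n → Bool) :
    ∃ Z, IsBarnesZeta (etaShift n y e) (etaPeriods n) Z ∧ ∀ N : ℕ, AnalyticAt ℂ Z (-(N : ℂ)) ∧
      Z (-(N : ℂ)) = (-1) ^ N * N.factorial / etaRoot n ^ (n * (n - 1) / 2) *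
        PowerSeries.coeff (n + N) (taylorSeries fun z => ∏ j : Fin n,
          bernoulliGen ((if e j then 1 - y else y : ℝ) : ℂ) (etaRoot n ^ (j : ℕ) * z)) := by
  have hpi := Real.pi_pos
  have hn' : (1 : ℝ) ≤ n := by exact_mod_cast hn
  set θ : ℝ := π * (n - 1) / (2 * n) with hθ
  set u := Complex.exp (-((θ : ℂ) * Complex.I)) with hu
  have hu0 : u ≠ 0 := Complex.exp_ne_zero _
  have hθ' : |θ| < π / 2 := by
    rw [abs_of_nonneg (div_nonneg (mul_nonneg hpi.le (by linarith)) (by positivity)),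
      div_lt_div_iff₀ (by positivity) two_pos]
    nlinarith
  set Y : Fin n → ℝ := fun j => if e j then y else 1 - y with hY
  have hYpos : ∀ j, 0 < Y j := fun j => by
    simp only [hY]
    split_ifs <;> linarith
  have hY1 : ∀ j, (if e j then 1 - y else y : ℝ) = 1 - Y j := fun j => by
    simp only [hY]
    split_ifs <;> ring
  have hω : ∀ j : Fin n, 0 < (u * etaPeriods n j).re := fun j =>
    re_rotated_etaRoot_pow_pos j.isLt
  have ha : u * etaShift n y e = ∑ j, u * etaPeriods n j * (Y j : ℂ) := by
    rw [etaShift, Finset.mul_sum]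
    exact Finset.sum_congr rfl fun j _ => by rw [etaPeriods, mul_assoc]
  have hare : 0 < (u * etaShift n y e).re := by
    rw [ha, Complex.re_sum]
    refine Finset.sum_pos (fun j _ => ?_) ⟨⟨0, hn⟩, Finset.mem_univ _⟩
    rw [Complex.re_mul_ofReal]
    exact mul_pos (hω j) (hYpos j)
  have hprod : ∏ j, u * etaPeriods n j = u ^ n * etaRoot n ^ (n * (n - 1) / 2) := by
    rw [Finset.prod_mul_distrib, ← prod_etaRoot_pow, Finset.prod_range]
    simp [etaPeriods]
  have han : ∀ j ∈ (Finset.univ : Finset (Fin n)),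
      AnalyticAt ℂ (fun z => bernoulliGen (1 - Y j) (u * etaPeriods n j * z)) 0 := fun j _ =>
    analyticAt_bernoulliGen_mul_zero _ _
  obtain ⟨Z, hZ, hval⟩ := exists_isBarnesZeta hn (a := etaShift n y e) (ω := etaPeriods n) hθ' hare
    hω (h := fun z => (∏ j, u * etaPeriods n j)⁻¹ *
      ∏ j, bernoulliGen (1 - Y j) (u * etaPeriods n j * z))
    (analyticAt_const.mul (Finset.analyticAt_fun_prod _ han)) fun t _ => by
      rw [← hu, ha]
      exact barnesKernel_eq_prod _ _ t
  refine ⟨Z, hZ, fun N => ⟨(hval N).1, ?_⟩⟩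
  have hresc : (taylorSeries fun z => ∏ j, bernoulliGen (1 - Y j) (u * etaPeriods n j * z)) =
      PowerSeries.rescale u (taylorSeries fun z => ∏ j : Fin n,
        bernoulliGen ((if e j then 1 - y else y : ℝ) : ℂ) (etaRoot n ^ (j : ℕ) * z)) := by
    rw [taylorSeries_prod _ han, taylorSeries_prod _ fun j _ =>
      analyticAt_bernoulliGen_mul_zero _ _, map_prod]
    refine Finset.prod_congr rfl fun j _ => ?_
    rw [hY1, ← taylorSeries_bernoulliGen_rescale _ (pow_ne_zero _ (etaRoot_ne_zero n)) hu0]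
    push_cast
    rfl
  have hexp : Complex.exp (θ * Complex.I) * u = 1 := by
    rw [hu, ← Complex.exp_add]
    simp
  have hE : etaRoot n ^ (n * (n - 1) / 2) ≠ 0 := pow_ne_zero _ (etaRoot_ne_zero n)
  rw [(hval N).2, taylorSeries_mul analyticAt_const (Finset.analyticAt_fun_prod _ han),
    taylorSeries_const, PowerSeries.coeff_C_mul, hresc, PowerSeries.coeff_rescale, hprod, pow_add]
  have h3 : Complex.exp (θ * Complex.I) ^ N * u ^ N = 1 := by rw [← mul_pow, hexp, one_pow]
  set C := PowerSeries.coeff (n + N) (taylorSeries fun z => ∏ j : Fin n,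
        bernoulliGen ((if e j then 1 - y else y : ℝ) : ℂ) (etaRoot n ^ (j : ℕ) * z))
  rw [div_mul_eq_mul_div, eq_div_iff hE]
  field_simp
  linear_combination ((N.factorial : ℂ) * C) * h3

/-- Summing over all choices of the `yⱼ` symmetrizes each factor of the product. -/
theorem sum_coeff_taylorSeries_bernoulliGen (n : ℕ) (y : ℝ) (k : ℕ) :
    ∑ e : Fin n → Bool, PowerSeries.coeff k (taylorSeries fun z => ∏ j : Fin n,
        bernoulliGen ((if e j then 1 - y else y : ℝ) : ℂ) (etaRoot n ^ (j : ℕ) * z)) =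
      PowerSeries.coeff k (taylorSeries (bernoulliProd n y)) := by
  have h1 : bernoulliProd n y = fun z => ∑ e : Fin n → Bool, ∏ j : Fin n,
      bernoulliGen ((if e j then 1 - y else y : ℝ) : ℂ) (etaRoot n ^ (j : ℕ) * z) := by
    funext z
    have h2 := Finset.prod_univ_sum (fun _ : Fin n => (Finset.univ : Finset Bool))
      fun j b => bernoulliGen ((if b then 1 - y else y : ℝ) : ℂ) (etaRoot n ^ (j : ℕ) * z)
    rw [Fintype.piFinset_univ] at h2
    rw [← h2, bernoulliProd, Finset.prod_range]
    refine Finset.prod_congr rfl fun j _ => ?_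
    rw [Fintype.sum_bool, bernoulliSym, add_comm]
    simp
  rw [h1, taylorSeries_sum _ fun e _ => Finset.analyticAt_fun_prod _ fun j _ =>
    analyticAt_bernoulliGen_mul_zero _ _, map_sum]

theorem IsBarnesZeta.barnesZeta_eq {n : ℕ} {a : ℂ} {ω : Fin n → ℂ} {Z : ℂ → ℂ}
    (h : IsBarnesZeta a ω Z) : (fun s => barnesZeta s a ω) = Z := by
  have hex : ∃ Z, IsBarnesZeta a ω Z := ⟨Z, h⟩
  rw [← hex.choose_spec.unique h]
  funext s
  rw [barnesZeta, dif_pos hex]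

theorem theorem6p1 (n : ℕ) (hn : 2 ≤ n) (p : ℤ) (y : ℝ)
    (h : (0 < y ∧ y < 1) ∨ ((y = 0 ∨ y = 1) ∧ (n : ℤ) < 2 * p)) :
    -- the bilateral series converges absolutely, and its value is given by Bernoulli polynomials
    (Summable fun m : {m : ℤ // m ≠ 0} => seriesTerm n p y m) ∧
    zFactor n (2 * p + 1) * ∑' m : {m : ℤ // m ≠ 0}, seriesTerm n p y m =
      -(2 ^ (n - 1) * (2 * π * Complex.I) ^ (2 * p + 1 - (n : ℤ)) /
          etaRoot n ^ (n * (n - 1) / 2)) * bernoulliSum n p y ∧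
    -- for `0 < y < 1` and `p ≥ n / 2` both sides are a sum of values of Barnes zeta-functions,
    -- which exist as meromorphic functions on `ℂ` and are regular at `n - 2p`
    (0 < y → y < 1 → (n : ℤ) ≤ 2 * p →
      (∀ e : Fin n → Bool,
        IsBarnesZeta (etaShift n y e) (etaPeriods n)
          (fun s => barnesZeta s (etaShift n y e) (etaPeriods n)) ∧
        AnalyticAt ℂ (fun s => barnesZeta s (etaShift n y e) (etaPeriods n)) (n - 2 * p)) ∧
      zFactor n (2 * p + 1) * ∑' m : {m : ℤ // m ≠ 0}, seriesTerm n p y m =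
        (2 * π * Complex.I) ^ (2 * p + 1 - (n : ℤ)) * (-1) ^ (1 - (n : ℤ)) /
            (2 * ((2 * p - (n : ℤ)).toNat.factorial : ℂ)) *
          ∑ e : Fin n → Bool,
            barnesZeta (n - 2 * p) (etaShift n y e) (etaPeriods n)) := by
  have htsum : ∑' m : {m : ℤ // m ≠ 0}, seriesTerm n p y m = ∑' m, seriesTerm n p y m :=
    tsum_subtype_eq_of_support_subset (s := {m : ℤ | m ≠ 0}) fun m hm h0 =>
      hm (by rw [h0, seriesTerm_zero hn])
  have hval := zFactor_mul_tsum_seriesTerm hn h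
  rw [← htsum] at hval
  refine ⟨(summable_seriesTerm hn h).subtype _, hval, fun hy0 hy1 hp => ?_⟩
  obtain ⟨N, hN⟩ : ∃ N : ℕ, (N : ℤ) = 2 * p - n := ⟨(2 * p - n).toNat, by omega⟩
  have hNc : (n : ℂ) - 2 * p = -(N : ℂ) := by
    have : (N : ℂ) = 2 * p - n := by exact_mod_cast congrArg (Int.cast : ℤ → ℂ) hN
    rw [this]
    ring
  have hex := fun e => exists_isBarnesZeta_etaShift (n := n) (by omega) hy0 hy1 e
  refine ⟨fun e => ?_, ?_⟩
  · obtain ⟨Z, hZ, hZN⟩ := hex e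
    rw [hZ.barnesZeta_eq, hNc]
    exact ⟨hZ, (hZN N).1⟩
  · have hz : ∀ e : Fin n → Bool, barnesZeta (n - 2 * p) (etaShift n y e) (etaPeriods n) =
        (-1) ^ N * N.factorial / etaRoot n ^ (n * (n - 1) / 2) *
        PowerSeries.coeff (n + N) (taylorSeries fun z => ∏ j : Fin n,
          bernoulliGen ((if e j then 1 - y else y : ℝ) : ℂ) (etaRoot n ^ (j : ℕ) * z)) := by
      intro e
      obtain ⟨Z, hZ, hZN⟩ := hex e
      rw [← (hZN N).2, ← hZ.barnesZeta_eq, hNc]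
    have hsign : (-1 : ℂ) ^ (1 - (n : ℤ)) * (-1) ^ N = -1 := by
      rw [← zpow_natCast, ← zpow_add₀ (neg_ne_zero.2 one_ne_zero), hN]
      exact Odd.neg_one_zpow ⟨p - n, by ring⟩
    have h2n : n + N = 2 * p.toNat := by omega
    have hpow : (2 : ℂ) ^ n = 2 * 2 ^ (n - 1) := by
      rw [← pow_succ', Nat.sub_add_cancel (by omega)]
    have hfac : (N.factorial : ℂ) ≠ 0 := by exact_mod_cast N.factorial_ne_zero
    rw [hval, Finset.sum_congr rfl fun e _ => hz e, ← Finset.mul_sum,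
      sum_coeff_taylorSeries_bernoulliGen, h2n, coeff_taylorSeries_bernoulliProd,
      Int.toNat_of_nonneg (by omega), ← hN, Int.toNat_natCast, hpow]
    have hE : etaRoot n ^ (n * (n - 1) / 2) ≠ 0 := pow_ne_zero _ (etaRoot_ne_zero n)
    set E := etaRoot n ^ (n * (n - 1) / 2)
    set T := (2 * π * Complex.I) ^ (2 * p + 1 - (n : ℤ))
    set σ := (-1 : ℂ) ^ (1 - (n : ℤ))
    set τ := (-1 : ℂ) ^ N
    clear_value τ σ T E
    field_simp
    linear_combination (-(T * bernoulliSum n p y)) * hsign
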